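/- Let $Q^n=[0,1]^n\subset\mathbb{R}^n$ with Lebesgue measure $|\cdot|$. For a Borel set $E\subseteq Q^n$ let $$A(E)=\sup\Big\{\int_E \operatorname{div}\varphi\,dx \;:\; \varphi\in C^1_c\big((0,1)^n;\mathbb{R}^n\big),\ |\varphi|\le 1\Big\}\in[0,\infty]$$ be its perimeter relative to the open cube; when it is finite, this is the $(n-1)$-dimensional Hausdorff measure of the part of the reduced boundary of $E$ inside $(0,1)^n$. A Borel set $E\subseteq Q^n$ is an *isoperimetric minimizer* of volume $\bar v$ if $|E|=\bar v$ and $A(E)=\inf\{A(E'): E'\subseteq Q^n \text{ Borel},\ |E'|=\bar v\}$. For a face $F$ of $Q^n$ and $r\in(0,1]$, the $r$-tubular neighborhood of $F$ is $F_r=\{x\in Q^n : \operatorname{dist}(x,F)\le r\}$. The *isoperimetric conjecture on $Q^n$* asserts: for every $\bar v\in(0,1)$ there exist $k\in\{0,1,\dots,n-1\}$, a $k$-dimensional face $F$ of $Q^n$ and $r\in(0,1]$ such that $F_r$ or its complement $Q^n\setminus F_r$ is an isoperimetric minimizer of volume $\bar v$. **Theorem 1.4.** The isoperimetric conjecture on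 $Q^n$ is false for every $n\ge 10$. More precisely, let $n\ge 10$, let $\omega_n=\pi^{n/2}/\Gamma(n/2+1)$ be the volume of the $n$-dimensional Euclidean unit ball, and let $B_1$ be the $1$-tubular neighborhood of a vertex of $Q^n$. Then: 1. $|B_1|=\omega_n/2^n$. 2. Let $F$ be a face of $Q^n$ of dimension $k\in\{0,\dots,n-1\}$, let $r\in(0,1]$, and let $E\in\{F_r,\,Q^n\setminus F_r\}$ have volume $\omega_n/2^n$. Then either $E$ is the $1$-tubular neighborhood of a vertex (that is, $k=0$, $r=1$, $E=F_r$), or $A(B_1)<A(E)$. 3. $B_1$ is not an isoperimetric minimizer of volume $\omega_n/2^n$. -/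

import Mathlib

open MeasureTheory Set
open scoped ENNReal

noncomputable section

/-- The closed unit cube `[0,1]^n` in Euclidean space. -/
def unitCube (n : ℕ) : Set (EuclideanSpace ℝ (Fin n)) :=
  {x | ∀ i, x i ∈ Icc (0 : ℝ) 1}

/-- `F` is a `k`-dimensional face of the unit cube: `n - k` of the coordinates are frozen, each at
one of the endpoints `0`, `1`, and the remaining `k` coordinates run over `[0,1]`. -/
def IsCubeFace (n k : ℕ) (F : Set (EuclideanSpace ℝ (Fin n))) : Prop :=
  ∃ (S : Finset (Fin n)) (ε : Fin n → ℝ), (∀ i, ε i = 0 ∨ ε i = 1) ∧ S.card + k = n ∧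
    F = {x | x ∈ unitCube n ∧ ∀ i ∈ S, x i = ε i}

/-- The (closed) `r`-tubular neighborhood of `F` in the unit cube: the points of the cube at
Euclidean distance at most `r` from `F`. -/
def tube (n : ℕ) (F : Set (EuclideanSpace ℝ (Fin n))) (r : ℝ) :
    Set (EuclideanSpace ℝ (Fin n)) :=
  Metric.cthickening r F ∩ unitCube n

/-- The divergence of a vector field, `∑ i, ∂ᵢ φᵢ`. -/
def divergence {n : ℕ} (φ : EuclideanSpace ℝ (Fin n) → EuclideanSpace ℝ (Fin n))
    (x : EuclideanSpace ℝ (Fin n)) : ℝ :=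
  ∑ i, fderiv ℝ φ x (EuclideanSpace.single i 1) i

/-- `φ` is a `C¹` vector field, compactly supported in the open set `U`, with `|φ| ≤ 1`. -/
structure IsPerimeterTestField {n : ℕ} (U : Set (EuclideanSpace ℝ (Fin n)))
    (φ : EuclideanSpace ℝ (Fin n) → EuclideanSpace ℝ (Fin n)) : Prop where
  contDiff : ContDiff ℝ 1 φ
  hasCompactSupport : HasCompactSupport φ
  tsupport_subset : tsupport φ ⊆ U
  norm_le_one : ∀ x, ‖φ x‖ ≤ 1

/-- De Giorgi's perimeter of `E` relative to the interior of the unit cube (the parts of the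
boundary of `E` on the boundary of the cube do not count). It is finite exactly when `E` has finite
perimeter in the open cube, and is then the `(n-1)`-dimensional Hausdorff measure of the part of the
reduced boundary of `E` inside the open cube. -/
def cubePerimeter (n : ℕ) (E : Set (EuclideanSpace ℝ (Fin n))) : ℝ≥0∞ :=
  ⨆ (φ : EuclideanSpace ℝ (Fin n) → EuclideanSpace ℝ (Fin n))
    (_ : IsPerimeterTestField (interior (unitCube n)) φ),
    ENNReal.ofReal (∫ x in E, divergence φ x)

/-- The isoperimetric profile of the unit cube. -/
def cubeProfile (n : ℕ) (v : ℝ) : ℝ≥0∞ :=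
  ⨅ (E : Set (EuclideanSpace ℝ (Fin n))) (_ : MeasurableSet E) (_ : E ⊆ unitCube n)
    (_ : volume E = ENNReal.ofReal v), cubePerimeter n E

/-- `E` is an isoperimetric minimizer of volume `v` in the unit cube. -/
def IsIsoperimetricMinimizer (n : ℕ) (v : ℝ) (E : Set (EuclideanSpace ℝ (Fin n))) : Prop :=
  MeasurableSet E ∧ E ⊆ unitCube n ∧ volume E = ENNReal.ofReal v ∧
    cubePerimeter n E = cubeProfile n v

/-- The isoperimetric conjecture on the `n`-dimensional unit cube: for every volume `v ∈ (0,1)`, the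
`r`-tubular neighborhood of some `k`-dimensional face, `0 ≤ k ≤ n - 1`, `0 < r ≤ 1`, or its
complement in the cube, is an isoperimetric minimizer of volume `v`. -/
def CubeIsoperimetricConjecture (n : ℕ) : Prop :=
  ∀ v ∈ Ioo (0 : ℝ) 1, ∃ k < n, ∃ r ∈ Ioc (0 : ℝ) 1, ∃ F, IsCubeFace n k F ∧
    (IsIsoperimetricMinimizer n v (tube n F r) ∨
      IsIsoperimetricMinimizer n v (unitCube n \ tube n F r))

/-- The volume `ω_n = π^(n/2) / Γ(n/2 + 1)` of the `n`-dimensional Euclidean unit ball. -/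
def omegaBall (n : ℕ) : ℝ :=
  Real.pi ^ ((n : ℝ) / 2) / Real.Gamma ((n : ℝ) / 2 + 1)

end

/-! Write w = ω_n / 2^n. The argument has two independent halves: every other tube of volume w is
worse than the corner ball `B₁`, and `B₁` itself can be improved.

Comparison. A tube of codimension m and radius r ≤ 1 is a 2^m-th part of a ball of radius r times a
cube, so its volume is (ω_m / 2^m) r^m, and for r < 1 its perimeter is at least m · volume / r. At
volume w this exceeds n w, the perimeter of `B₁`, as soon as r < m / n, that is, as soon as w < (ω_m
/ 2^m) (m / n)^m. For n ≥ 10 the right-hand side decreases strictly in m from 1 to n, where it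
equals w (`omegaBall_div_lt`). A complement of volume w comes from a tube of volume 1 - w > 9/10;
this forces codimension one, hence perimeter at least 1 > n w.

Improvement. The unit sphere around a vertex touches an opposite wall tangentially at the far end of
an edge. Fill this cusp with a column of cross-section [0, ρ]^(n-1) along the edge. The spherical
piece over the column disappears, and its area is at least that of its projection, ρ^(n-1). The
lateral boundary of the column outside the ball has height O(ρ²) by tangency, hence area O(ρ^n).
Restoring the volume shrinks the radius, which only lowers the spherical area and, since 1 - r² ≤ ρ²
/ w, keeps the height O(ρ²). For small ρ perimeter is saved (`exists_cubePerimeter_lt`).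

Perimeters are controlled directly from the definition: from above by the outer Minkowski content
(`cubePerimeter_le_of_outerShell`), from below by testing with a truncated radial field
(`le_cubePerimeter_faceTube_of_tendsto`). -/

/-! ### Reflections and volumes of ball sectors -/

theorem volume_eq_two_mul_halfspace {ι : Type*} [Fintype ι] [DecidableEq ι] {A : Set (ι → ℝ)}
    (hA : MeasurableSet A) (i : ι) (c : ℝ) {s : ℝ} (hs : s ≠ 0)
    (hinv : ∀ x, Function.update x i (2 * c - x i) ∈ A ↔ x ∈ A) :
    volume A = 2 * volume (A ∩ {x | 0 ≤ s * (x i - c)}) := by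
  have hm : Measurable fun x : ι → ℝ => s * (x i - c) := by fun_prop
  have hmp : MeasurePreserving (fun x : ι → ℝ => Function.update x i (2 * c - x i)) := by
    have h := volume_preserving_pi (ι := ι) (α' := fun _ => ℝ) (β' := fun _ => ℝ)
      (f := fun j t => if j = i then 2 * c - t else t) (fun j => by
        by_cases hj : j = i
        · simpa [hj] using Measure.measurePreserving_sub_left volume (2 * c)
        · simp only [hj, if_false]; exact MeasurePreserving.id (volume : Measure ℝ))
    convert h using 1
    funext x j
    by_cases hj : j = i
    · subst hj; simp
    · simp [hj]
  have h0 : volume {x : ι → ℝ | x i = c} = 0 := Measure.pi_hyperplane (fun _ => (volume : Measure ℝ)) i c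
  have hlt : volume (A ∩ {x | 0 < s * (x i - c)}) = volume (A ∩ {x | 0 ≤ s * (x i - c)}) := by
    apply le_antisymm
    · exact measure_mono fun x hx => ⟨hx.1, le_of_lt (mem_ofPred_eq ▸ hx.2)⟩
    · calc volume (A ∩ {x | 0 ≤ s * (x i - c)})
          ≤ volume ((A ∩ {x | 0 < s * (x i - c)}) ∪ {x | x i = c}) := by
            apply measure_mono
            rintro x ⟨hx, hx'⟩
            rcases eq_or_ne (x i) c with h | h
            · exact Or.inr h
            · exact Or.inl ⟨hx, lt_of_le_of_ne hx' (mul_ne_zero hs (sub_ne_zero.2 h)).symm⟩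
        _ ≤ volume (A ∩ {x | 0 < s * (x i - c)}) + 0 := by
            rw [← h0]; exact measure_union_le _ _
        _ = _ := add_zero _
  have hneg : volume (A \ {x | 0 ≤ s * (x i - c)}) = volume (A ∩ {x | 0 < s * (x i - c)}) := by
    rw [← hmp.measure_preimage
      (hA.inter (measurableSet_lt measurable_const hm)).nullMeasurableSet]
    congr 1
    ext x
    simp only [mem_sdiff, mem_ofPred_eq, mem_preimage, mem_inter_iff, hinv, Function.update_self,
      not_le]
    refine and_congr_right fun _ => ?_
    constructor <;> intro h <;> nlinarith
  rw [← measure_inter_add_sdiff A (measurableSet_le measurable_const hm), hneg, hlt, two_mul]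

/-- Halve once per coordinate: after cutting in some coordinates the set is still symmetric in the
remaining ones, because a reflection moves only its own coordinate. -/
theorem volume_eq_two_pow_mul_orthant {ι : Type*} [Fintype ι] [DecidableEq ι] {A : Set (ι → ℝ)}
    (hA : MeasurableSet A) (T : Finset ι) (c s : ι → ℝ) (hs : ∀ i, s i ≠ 0)
    (hinv : ∀ i ∈ T, ∀ x, Function.update x i (2 * c i - x i) ∈ A ↔ x ∈ A) :
    volume A = 2 ^ T.card * volume (A ∩ {x | ∀ i ∈ T, 0 ≤ s i * (x i - c i)}) := by
  induction T using Finset.induction_on with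
  | empty => simp
  | insert j T hj ih =>
    rw [ih fun i hi => hinv i (Finset.mem_insert_of_mem hi), Finset.card_insert_of_notMem hj,
      pow_succ, mul_assoc]
    congr 1
    have hms : MeasurableSet {x : ι → ℝ | ∀ i ∈ T, 0 ≤ s i * (x i - c i)} := by
      have : {x : ι → ℝ | ∀ i ∈ T, 0 ≤ s i * (x i - c i)} =
          ⋂ i ∈ T, {x | 0 ≤ s i * (x i - c i)} := by ext; simp
      rw [this]
      exact Finset.measurableSet_biInter _ fun i _ => measurableSet_le measurable_const (by fun_prop)
    rw [volume_eq_two_mul_halfspace (hA.inter hms) j (c j) (hs j)]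
    · congr 2
      ext x
      simp only [mem_inter_iff, mem_ofPred_eq, Finset.forall_mem_insert]
      tauto
    · intro x
      simp only [mem_inter_iff, mem_ofPred_eq, hinv j (Finset.mem_insert_self _ _)]
      refine and_congr_right fun _ => forall₂_congr fun i hi => ?_
      rw [Function.update_of_ne (by rintro rfl; exact hj hi)]

theorem omegaBall_eq (n : ℕ) :
    omegaBall n = √Real.pi ^ n / Real.Gamma ((n : ℝ) / 2 + 1) := by
  rw [omegaBall, Real.sqrt_eq_rpow, ← Real.rpow_mul_natCast Real.pi_pos.le]
  congr 2; ring

theorem omegaBall_pos (n : ℕ) : 0 < omegaBall n := by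
  have := Real.pi_pos
  have := Real.Gamma_pos_of_pos (show (0 : ℝ) < (n : ℝ) / 2 + 1 by positivity)
  unfold omegaBall
  positivity

theorem volume_pi_ball {ι : Type*} [Fintype ι] [Nonempty ι] (c : ι → ℝ) {r : ℝ} (hr : 0 ≤ r) :
    volume {y : ι → ℝ | ∑ i, (y i - c i) ^ 2 ≤ r ^ 2} =
      ENNReal.ofReal (omegaBall (Fintype.card ι) * r ^ Fintype.card ι) := by
  have h := (PiLp.volume_preserving_ofLp ι).measure_preimage
    (s := {y : ι → ℝ | ∑ i, (y i - c i) ^ 2 ≤ r ^ 2})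
    (measurableSet_le (by fun_prop) measurable_const).nullMeasurableSet
  rw [← h, omegaBall_eq, mul_comm, ENNReal.ofReal_mul (by positivity), ENNReal.ofReal_pow hr,
    ← EuclideanSpace.volume_closedBall ι (WithLp.toLp 2 c) r]
  congr 1
  ext x
  simp only [mem_preimage, mem_ofPred_eq, Metric.mem_closedBall, EuclideanSpace.dist_eq,
    Real.dist_eq, sq_abs]
  rw [Real.sqrt_le_left hr]

/-- The part of the solid cylinder of radius `r` around the face `{x i = ε i, i ∈ S}` which lies
on the inner side of the walls `{x i = ε i}`, `i ∈ S`. -/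
def cylinderSector (n : ℕ) (S : Finset (Fin n)) (ε : Fin n → ℝ) (r : ℝ) :
    Set (EuclideanSpace ℝ (Fin n)) :=
  {x | (∑ i ∈ S, (x i - ε i) ^ 2 ≤ r ^ 2 ∧ ∀ j ∉ S, x j ∈ Icc (0 : ℝ) 1) ∧
    ∀ i ∈ S, 0 ≤ (1 - 2 * ε i) * (x i - ε i)}

/-- The full cylinder, a ball in the `S`-coordinates times a unit cube in the others, is symmetric
about each `x i = ε i`, and the sector is one of its `2 ^ S.card` congruent pieces. The sign `1 - 2
* ε i` points into the cube. -/
theorem volume_cylinderSector {n : ℕ} {S : Finset (Fin n)} {ε : Fin n → ℝ}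
    (hε : ∀ i, ε i = 0 ∨ ε i = 1) (hS : S.Nonempty) {r : ℝ} (hr : 0 ≤ r) :
    volume (cylinderSector n S ε r) =
      ENNReal.ofReal (omegaBall S.card / 2 ^ S.card * r ^ S.card) := by
  classical
  set A : Set (Fin n → ℝ) := {x | ∑ i ∈ S, (x i - ε i) ^ 2 ≤ r ^ 2 ∧ ∀ j ∉ S, x j ∈ Icc (0 : ℝ) 1}
  have hA : MeasurableSet A := by
    have : A = {x | ∑ i ∈ S, (x i - ε i) ^ 2 ≤ r ^ 2} ∩
        ⋂ j ∈ Sᶜ, (fun x : Fin n → ℝ => x j) ⁻¹' Icc (0 : ℝ) 1 := by ext; simp [A]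
    rw [this]
    exact (measurableSet_le (by fun_prop) measurable_const).inter
      (Finset.measurableSet_biInter _ fun j _ => measurableSet_Icc.preimage (measurable_pi_apply j))
  have h1 := volume_eq_two_pow_mul_orthant hA S ε (fun i => 1 - 2 * ε i)
    (fun i => by rcases hε i with h | h <;> norm_num [h]) (by
      intro i hi x
      have h1 : ∑ j ∈ S, (Function.update x i (2 * ε i - x i) j - ε j) ^ 2 =
          ∑ j ∈ S, (x j - ε j) ^ 2 := by
        refine Finset.sum_congr rfl fun j _ => ?_
        by_cases hj : j = i
        · subst hj; simp; ring
        · simp [hj]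
      simp only [A, mem_ofPred_eq, h1]
      refine and_congr_right fun _ => forall₂_congr fun j hj => ?_
      rw [Function.update_of_ne (by rintro rfl; exact hj hi)])
  have h2 : volume A = ENNReal.ofReal (omegaBall S.card * r ^ S.card) := by
    have hne : Nonempty {i // i ∈ S} := hS.to_subtype
    have hmp := volume_preserving_piEquivPiSubtypeProd (fun _ : Fin n => ℝ) (fun i => i ∈ S)
    have hB := volume_pi_ball (fun i : {i // i ∈ S} => ε i) hr
    rw [Fintype.card_coe] at hB
    have hI : volume (Set.pi univ fun _ : {i // i ∉ S} => Icc (0 : ℝ) 1) = 1 := by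
      rw [volume_pi_pi]; simp
    have hpre := hmp.measure_preimage
      (s := {y : {i // i ∈ S} → ℝ | ∑ i, (y i - ε i) ^ 2 ≤ r ^ 2} ×ˢ
        Set.pi univ fun _ : {i // i ∉ S} => Icc (0 : ℝ) 1)
      ((measurableSet_le (by fun_prop) measurable_const).prod
        (MeasurableSet.univ_pi fun _ => measurableSet_Icc)).nullMeasurableSet
    rw [Measure.volume_eq_prod, Measure.prod_prod, hI, mul_one] at hpre
    rw [← hB]
    refine Eq.trans ?_ (hpre.trans (by congr!))
    congr 1
    ext x
    simp only [A, mem_ofPred_eq, mem_preimage, mem_prod,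
      MeasurableEquiv.piEquivPiSubtypeProd_apply, Set.mem_pi, mem_univ, true_imp_iff,
      Subtype.forall]
    rw [← Finset.sum_coe_sort S]
  have hC : volume (cylinderSector n S ε r) =
      volume (A ∩ {x | ∀ i ∈ S, 0 ≤ (1 - 2 * ε i) * (x i - ε i)}) := by
    rw [← (PiLp.volume_preserving_ofLp (Fin n)).measure_preimage]
    · rfl
    · refine (hA.inter ?_).nullMeasurableSet
      have : {x : Fin n → ℝ | ∀ i ∈ S, 0 ≤ (1 - 2 * ε i) * (x i - ε i)} =
          ⋂ i ∈ S, {x | 0 ≤ (1 - 2 * ε i) * (x i - ε i)} := by ext; simp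
      rw [this]
      exact Finset.measurableSet_biInter _ fun i _ => measurableSet_le measurable_const (by fun_prop)
  rw [← hC, h2] at h1
  have h3 : ENNReal.ofReal (omegaBall S.card * r ^ S.card) =
      2 ^ S.card * ENNReal.ofReal (omegaBall S.card / 2 ^ S.card * r ^ S.card) := by
    have : (2 : ℝ≥0∞) ^ S.card = ENNReal.ofReal (2 ^ S.card) := by
      rw [ENNReal.ofReal_pow (by norm_num)]; norm_num
    rw [this, ← ENNReal.ofReal_mul (by positivity)]
    congr 1
    field_simp
  rw [h3] at h1
  exact ((ENNReal.mul_right_inj (by positivity) (by finiteness)).1 h1).symm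

/-! ### Tubes around faces and their volumes -/

/-- The points of the cube at distance at most `r` from the face `{x i = ε i, i ∈ S}`. -/
def faceTube (n : ℕ) (S : Finset (Fin n)) (ε : Fin n → ℝ) (r : ℝ) :
    Set (EuclideanSpace ℝ (Fin n)) :=
  {x | x ∈ unitCube n ∧ ∑ i ∈ S, (x i - ε i) ^ 2 ≤ r ^ 2}

theorem faceTube_subset_cylinderSector {n : ℕ} {S : Finset (Fin n)} {ε : Fin n → ℝ}
    (hε : ∀ i, ε i = 0 ∨ ε i = 1) (r : ℝ) :
    faceTube n S ε r ⊆ cylinderSector n S ε r := by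
  rintro x ⟨hx, hr⟩
  refine ⟨⟨hr, fun j _ => hx j⟩, fun i _ => ?_⟩
  have h1 := (hx i).1
  have h2 := (hx i).2
  rcases hε i with h | h <;> rw [h] <;> linarith

/-- For `r ≤ 1` the sector does not reach past the opposite walls. For larger radii only the
inclusion above survives, which suffices for upper bounds on volumes. -/
theorem faceTube_eq_cylinderSector {n : ℕ} {S : Finset (Fin n)} {ε : Fin n → ℝ}
    (hε : ∀ i, ε i = 0 ∨ ε i = 1) {r : ℝ} (hr : r ∈ Icc (0 : ℝ) 1) :
    faceTube n S ε r = cylinderSector n S ε r := by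
  refine (faceTube_subset_cylinderSector hε r).antisymm ?_
  rintro x ⟨⟨hx, hj⟩, hi⟩
  refine ⟨fun i => ?_, hx⟩
  by_cases his : i ∈ S
  · have h1 := hi i his
    have h2 : (x i - ε i) ^ 2 ≤ 1 := by
      refine (Finset.single_le_sum (f := fun i => (x i - ε i) ^ 2) (fun i _ => sq_nonneg _)
        his).trans (hx.trans ?_)
      exact pow_le_one₀ hr.1 hr.2
    have h3 := (sq_le_one_iff_abs_le_one _).1 h2
    rw [abs_le] at h3
    rcases hε i with h | h <;> rw [h] at h1 h3 <;> constructor <;> linarith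
  · exact hj i his

theorem volume_faceTube {n : ℕ} {S : Finset (Fin n)} {ε : Fin n → ℝ}
    (hε : ∀ i, ε i = 0 ∨ ε i = 1) (hS : S.Nonempty) {r : ℝ} (hr : r ∈ Icc (0 : ℝ) 1) :
    volume (faceTube n S ε r) =
      ENNReal.ofReal (omegaBall S.card / 2 ^ S.card * r ^ S.card) := by
  rw [faceTube_eq_cylinderSector hε hr, volume_cylinderSector hε hS hr.1]

theorem isClosed_unitCube (n : ℕ) : IsClosed (unitCube n) := by
  simp only [unitCube, ofPred_forall]
  exact isClosed_iInter fun i => isClosed_Icc.preimage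
    (show Continuous fun x : EuclideanSpace ℝ (Fin n) => x i by fun_prop)

theorem isClosed_faceTube (n : ℕ) (S : Finset (Fin n)) (ε : Fin n → ℝ) (r : ℝ) :
    IsClosed (faceTube n S ε r) :=
  (isClosed_unitCube n).inter (isClosed_le (show Continuous fun x : EuclideanSpace ℝ (Fin n) =>
    ∑ i ∈ S, (x i - ε i) ^ 2 by fun_prop) continuous_const)

theorem unitCube_eq_preimage (n : ℕ) :
    unitCube n = WithLp.ofLp ⁻¹' (Set.pi univ fun _ : Fin n => Icc (0 : ℝ) 1) := by
  ext x; simp [unitCube, Pi.le_def, forall_and]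

theorem volume_preimage_ofLp_pi {n : ℕ} (a b : Fin n → ℝ) :
    volume {x : EuclideanSpace ℝ (Fin n) | ∀ i, x i ∈ Icc (a i) (b i)} =
      ∏ i, ENNReal.ofReal (b i - a i) := by
  have h := (PiLp.volume_preserving_ofLp (Fin n)).measure_preimage
    (s := Set.pi univ fun i : Fin n => Icc (a i) (b i))
    (MeasurableSet.univ_pi fun _ => measurableSet_Icc).nullMeasurableSet
  rw [volume_pi_pi] at h
  simp only [Real.volume_Icc] at h
  rw [← h]
  congr 1
  ext x; simp [Pi.le_def, forall_and]

theorem volume_unitCube (n : ℕ) : volume (unitCube n) = 1 := by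
  have h := volume_preimage_ofLp_pi (n := n) (fun _ => 0) (fun _ => 1)
  simpa [unitCube] using h

theorem isCompact_unitCube (n : ℕ) : IsCompact (unitCube n) := by
  rw [unitCube_eq_preimage]
  exact (PiLp.homeomorph 2 (fun _ : Fin n => ℝ)).isClosedEmbedding.isCompact_preimage
    (isCompact_univ_pi fun _ => isCompact_Icc)

/-- The nearest point of the face is obtained by resetting the `S`-coordinates to `ε`. Compactness
of the face makes the distance attained, so the closed thickening is a union of closed balls. -/
theorem tube_face_eq_faceTube {n : ℕ} {S : Finset (Fin n)} {ε : Fin n → ℝ}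
    (hε : ∀ i, ε i = 0 ∨ ε i = 1) {r : ℝ} (hr : 0 ≤ r) :
    tube n {x | x ∈ unitCube n ∧ ∀ i ∈ S, x i = ε i} r = faceTube n S ε r := by
  classical
  have hF : IsCompact {x : EuclideanSpace ℝ (Fin n) | x ∈ unitCube n ∧ ∀ i ∈ S, x i = ε i} := by
    refine (isCompact_unitCube n).of_isClosed_subset ?_ fun x hx => hx.1
    have : {x : EuclideanSpace ℝ (Fin n) | x ∈ unitCube n ∧ ∀ i ∈ S, x i = ε i} =
        unitCube n ∩ ⋂ i ∈ S, {x | x i = ε i} := by ext; simp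
    rw [this]
    exact (isClosed_unitCube n).inter
      (isClosed_biInter fun i _ => isClosed_eq
        (show Continuous fun x : EuclideanSpace ℝ (Fin n) => x i by fun_prop) continuous_const)
  rw [tube, hF.cthickening_eq_biUnion_closedBall hr]
  ext x
  simp only [mem_inter_iff, mem_iUnion, exists_prop, Metric.mem_closedBall, faceTube, mem_ofPred_eq,
    EuclideanSpace.dist_eq, Real.dist_eq, sq_abs, Real.sqrt_le_left hr]
  constructor
  · rintro ⟨⟨y, ⟨_, hy⟩, hxy⟩, hx⟩
    refine ⟨hx, le_trans ?_ hxy⟩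
    rw [Finset.sum_congr rfl fun i hi => by rw [← hy i hi]]
    exact Finset.sum_le_sum_of_subset_of_nonneg (Finset.subset_univ _) fun _ _ _ => sq_nonneg _
  · rintro ⟨hx, hxr⟩
    refine ⟨⟨WithLp.toLp 2 fun i => if i ∈ S then ε i else x i, ⟨fun i => ?_, fun i hi => ?_⟩,
      le_of_eq_of_le ?_ hxr⟩, hx⟩
    · by_cases hi : i ∈ S
      · rcases hε i with h | h <;> simp [hi, h]
      · simpa [hi] using hx i
    · simp [hi]
    · rw [← Finset.sum_subset (Finset.subset_univ S)]
      · exact Finset.sum_congr rfl fun i hi => by simp [hi]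
      · intro i _ hi
        simp [hi]

/-! ### Numerical estimates for volumes of unit balls -/

theorem omegaBall_add_two (n : ℕ) :
    omegaBall (n + 2) = omegaBall n * (2 * Real.pi / (n + 2)) := by
  have hG : Real.Gamma (((n + 2 : ℕ) : ℝ) / 2 + 1) =
      ((n : ℝ) / 2 + 1) * Real.Gamma ((n : ℝ) / 2 + 1) := by
    rw [← Real.Gamma_add_one (by positivity)]
    congr 1; push_cast; ring
  have hpos := Real.Gamma_pos_of_pos (show (0 : ℝ) < (n : ℝ) / 2 + 1 by positivity)
  rw [omegaBall_eq, omegaBall_eq, hG, pow_add, Real.sq_sqrt Real.pi_pos.le]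
  field_simp

theorem omegaBall_zero : omegaBall 0 = 1 := by simp [omegaBall]

theorem omegaBall_one : omegaBall 1 = 2 := by
  have h : Real.Gamma (1 / 2 + 1) = 1 / 2 * √Real.pi := by
    rw [Real.Gamma_add_one (by norm_num), Real.Gamma_one_half_eq]
  have := Real.sqrt_pos.2 Real.pi_pos
  rw [omegaBall_eq, Nat.cast_one, h]
  field_simp

/-- The ratio of the volumes of the unit balls in two consecutive dimensions. -/
noncomputable def omegaRatio (n : ℕ) : ℝ := omegaBall (n + 1) / omegaBall n

theorem omegaRatio_pos (n : ℕ) : 0 < omegaRatio n := div_pos (omegaBall_pos _) (omegaBall_pos _)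

/-- The two-step recursion has rational factors below one, so the ratios decrease along each parity
class, starting from 2 (even) and π / 2 (odd). -/
theorem omegaRatio_add_two (n : ℕ) :
    omegaRatio (n + 2) = omegaRatio n * ((n + 2) / (n + 3)) := by
  have h0 := omegaBall_pos n
  have h1 := omegaBall_pos (n + 1)
  have := Real.pi_pos
  rw [omegaRatio, omegaRatio, omegaBall_add_two n, show n + 2 + 1 = n + 1 + 2 by ring,
    omegaBall_add_two (n + 1)]
  push_cast
  field_simp
  ring

theorem omegaRatio_zero : omegaRatio 0 = 2 := by
  rw [omegaRatio, omegaBall_zero, omegaBall_one, div_one]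

theorem omegaRatio_one : omegaRatio 1 = Real.pi / 2 := by
  rw [omegaRatio, omegaBall_one, omegaBall_add_two 0, omegaBall_zero]
  norm_num

theorem omegaRatio_even : omegaRatio 2 = 4 / 3 ∧ omegaRatio 4 = 16 / 15 ∧
    omegaRatio 6 = 32 / 35 ∧ omegaRatio 8 = 256 / 315 ∧ omegaRatio 10 = 512 / 693 ∧
    omegaRatio 12 = 2048 / 3003 := by
  have h2 := omegaRatio_add_two 0
  have h4 := omegaRatio_add_two 2
  have h6 := omegaRatio_add_two 4
  have h8 := omegaRatio_add_two 6
  have h10 := omegaRatio_add_two 8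
  have h12 := omegaRatio_add_two 10
  rw [omegaRatio_zero] at h2
  norm_num at h2 h4 h6 h8 h10 h12
  rw [h2] at h4
  rw [h4] at h6
  rw [h6] at h8
  rw [h8] at h10
  rw [h10] at h12
  refine ⟨h2, ?_, ?_, ?_, ?_, ?_⟩ <;> linarith

theorem omegaRatio_odd : omegaRatio 3 = 3 * Real.pi / 8 ∧ omegaRatio 5 = 5 * Real.pi / 16 ∧
    omegaRatio 7 = 35 * Real.pi / 128 ∧ omegaRatio 9 = 63 * Real.pi / 256 ∧
    omegaRatio 11 = 231 * Real.pi / 1024 := by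
  have h3 := omegaRatio_add_two 1
  have h5 := omegaRatio_add_two 3
  have h7 := omegaRatio_add_two 5
  have h9 := omegaRatio_add_two 7
  have h11 := omegaRatio_add_two 9
  rw [omegaRatio_one] at h3
  norm_num at h3 h5 h7 h9 h11
  rw [h3] at h5
  rw [h5] at h7
  rw [h7] at h9
  rw [h9] at h11
  refine ⟨?_, ?_, ?_, ?_, ?_⟩ <;> linarith

theorem omegaRatio_le {j : ℕ} (hj : 11 ≤ j) : omegaRatio j ≤ 0.7088 := by
  induction j using Nat.strong_induction_on with
  | _ j ih =>
    rcases lt_or_ge j 13 with h | h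
    · interval_cases j
      · rw [omegaRatio_odd.2.2.2.2]
        have := Real.pi_lt_d4
        norm_num at this ⊢
        linarith
      · rw [omegaRatio_even.2.2.2.2.2]; norm_num
    · obtain ⟨i, rfl⟩ := Nat.exists_eq_add_of_le' (show 2 ≤ j by omega)
      rw [omegaRatio_add_two]
      refine le_trans (mul_le_of_le_one_right (omegaRatio_pos i).le ?_) (ih i (by omega) (by omega))
      rw [div_le_one (by positivity)]
      linarith

theorem omegaRatio_le_two (j : ℕ) : omegaRatio j ≤ 2 := by
  induction j using Nat.strong_induction_on with
  | _ j ih =>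
    rcases lt_or_ge j 2 with h | h
    · interval_cases j
      · rw [omegaRatio_zero]
      · rw [omegaRatio_one]; linarith [Real.pi_lt_four]
    · obtain ⟨i, rfl⟩ := Nat.exists_eq_add_of_le' h
      rw [omegaRatio_add_two]
      refine le_trans (mul_le_of_le_one_right (omegaRatio_pos i).le ?_) (ih i (by omega))
      rw [div_le_one (by positivity)]
      linarith

/-- From `j = 11` on, `(1 + 1 / j) ^ j ≤ e` and `0.7088 * e < 2` suffice. The cases 9 and 10 need
exact values; at `j = 9` the product is about 1.995. -/
theorem omegaRatio_mul_lt_two {j : ℕ} (hj : 9 ≤ j) :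
    omegaRatio j * ((j + 1) / j : ℝ) ^ j < 2 := by
  rcases lt_or_ge j 11 with h | h
  · have := Real.pi_lt_d4
    interval_cases j
    · rw [omegaRatio_odd.2.2.2.1]
      norm_num at this ⊢
      linarith
    · rw [omegaRatio_even.2.2.2.2.1]; norm_num
  · have hj0 : (0 : ℝ) < j := by exact_mod_cast (by omega : 0 < j)
    have h1 : ((j + 1) / j : ℝ) ^ j ≤ Real.exp 1 := by
      have h2 : ((j + 1) / j : ℝ) ≤ Real.exp (1 / j) := by
        have := Real.add_one_le_exp (1 / j : ℝ)
        have h3 : ((j + 1) / j : ℝ) = 1 / j + 1 := by field_simp; ring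
        rw [h3]; exact this
      calc ((j + 1) / j : ℝ) ^ j ≤ Real.exp (1 / j) ^ j := by gcongr
        _ = Real.exp 1 := by rw [← Real.exp_nat_mul]; congr 1; field_simp
    calc omegaRatio j * ((j + 1) / j : ℝ) ^ j ≤ 0.7088 * Real.exp 1 := by
          gcongr; exact omegaRatio_le h
      _ < 2 := by have := Real.exp_one_lt_d9; norm_num at this ⊢; linarith

/-- This is where `n ≥ 10` matters. For `j ≤ 8` the left side stays below 20, the largest value
being about 18.77 at `j = 8`; that value exceeds 18, so the inequality fails for `n = 9`. -/
theorem omegaRatio_mul_lt {n j : ℕ} (hn : 10 ≤ n) (hj : 1 ≤ j) (hjn : j < n) :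
    omegaRatio j * ((j + 1) / j : ℝ) ^ j * (j + 1) < 2 * n := by
  have hn' : (10 : ℝ) ≤ n := by exact_mod_cast hn
  rcases lt_or_ge j 9 with h | h
  · refine lt_of_lt_of_le ?_ (show (20 : ℝ) ≤ 2 * n by linarith)
    have := Real.pi_lt_d4
    obtain ⟨e2, e4, e6, e8, -⟩ := omegaRatio_even
    obtain ⟨e3, e5, e7, -⟩ := omegaRatio_odd
    have e1 := omegaRatio_one
    interval_cases j <;> simp only [e1, e2, e3, e4, e5, e6, e7, e8] <;> norm_num at this ⊢ <;>
      linarith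
  · have h1 := omegaRatio_mul_lt_two h
    have h2 : (j : ℝ) + 1 ≤ n := by exact_mod_cast hjn
    have h3 : (0 : ℝ) < j + 1 := by positivity
    nlinarith

/-- The volume `ω_m / 2^m` of the orthant of the unit ball decreases strictly, relative to
`(n / m) ^ m`, up to dimension `n`. -/
theorem omegaBall_div_lt {n m : ℕ} (hn : 10 ≤ n) (hm : 1 ≤ m) (hmn : m < n) :
    omegaBall n / 2 ^ n < omegaBall m / 2 ^ m * ((m : ℝ) / n) ^ m := by
  have hn0 : (0 : ℝ) < n := by exact_mod_cast (by omega : 0 < n)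
  -- The quotient of consecutive terms is `omegaRatio j * ((j + 1) / j) ^ j * (j + 1) / (2 * n)`,
  -- which is below one.
  have step : ∀ j : ℕ, 1 ≤ j → j < n →
      omegaBall (j + 1) / 2 ^ (j + 1) * (((j + 1 : ℕ) : ℝ) / n) ^ (j + 1) <
        omegaBall j / 2 ^ j * ((j : ℝ) / n) ^ j := by
    intro j hj hjn
    have hj0 : (0 : ℝ) < j := by exact_mod_cast hj
    have hw := omegaBall_pos j
    have h := omegaRatio_mul_lt hn hj hjn
    have e1 : omegaBall (j + 1) / 2 ^ (j + 1) * (((j + 1 : ℕ) : ℝ) / n) ^ (j + 1) =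
        omegaBall j / 2 ^ j * ((j : ℝ) / n) ^ j *
          (omegaRatio j * ((j + 1) / j : ℝ) ^ j * (j + 1) / (2 * n)) := by
      rw [omegaRatio, Nat.cast_add, Nat.cast_one]
      simp only [div_pow, pow_succ]
      field_simp
    rw [e1]
    refine mul_lt_of_lt_one_right (by positivity) ?_
    rwa [div_lt_one (by positivity)]
  have key : ∀ d j : ℕ, 1 ≤ j → j + (d + 1) = n →
      omegaBall n / 2 ^ n < omegaBall j / 2 ^ j * ((j : ℝ) / n) ^ j := by
    intro d
    induction d with
    | zero =>
      intro j hj hjn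
      have := step j hj (by omega)
      obtain rfl : j + 1 = n := hjn
      rwa [div_self hn0.ne', one_pow, mul_one] at this
    | succ d ih =>
      intro j hj hjn
      exact (ih (j + 1) (by omega) (by omega)).trans (step j hj (by omega))
  exact key (n - m - 1) m hm (by omega)

theorem omegaBall_div_lt_inv {n : ℕ} (hn : 10 ≤ n) : omegaBall n / 2 ^ n < 1 / n := by
  have h := omegaBall_div_lt hn le_rfl (by omega : 1 < n)
  simpa [omegaBall_one] using h

/-- Ratios of consecutive ball volumes are at most 2, so `ω_m / 2 ^ m` is nonincreasing, and it
equals π / 4 at `m = 2`. This excludes large tubes of codimension at least two. -/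
theorem omegaBall_div_le {m : ℕ} (hm : 2 ≤ m) : omegaBall m / 2 ^ m ≤ Real.pi / 4 := by
  induction m, hm using Nat.le_induction with
  | base => rw [omegaBall_add_two 0, omegaBall_zero]; norm_num
  | succ m hm ih =>
    refine le_trans ?_ ih
    have hw := omegaBall_pos m
    have h := omegaRatio_le_two m
    rw [omegaRatio, div_le_iff₀ hw] at h
    rw [pow_succ, div_le_div_iff₀ (by positivity) (by positivity)]
    have : (0 : ℝ) < 2 ^ m := by positivity
    nlinarith

/-! ### Test fields and integration by parts -/

section TestField

variable {n : ℕ} {U : Set (EuclideanSpace ℝ (Fin n))}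
  {φ : EuclideanSpace ℝ (Fin n) → EuclideanSpace ℝ (Fin n)}

theorem IsPerimeterTestField.contDiff_coord (hφ : IsPerimeterTestField U φ) (i : Fin n) :
    ContDiff ℝ 1 fun x => φ x i :=
  contDiff_euclidean.1 hφ.contDiff i

theorem IsPerimeterTestField.hasCompactSupport_coord (hφ : IsPerimeterTestField U φ) (i : Fin n) :
    HasCompactSupport fun x => φ x i :=
  hφ.hasCompactSupport.comp_left (g := fun y : EuclideanSpace ℝ (Fin n) => y i) rfl

theorem IsPerimeterTestField.continuous_divergence (hφ : IsPerimeterTestField U φ) :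
    Continuous (divergence φ) := by
  have h := hφ.contDiff.continuous_fderiv (by norm_num)
  unfold divergence
  fun_prop

theorem divergence_eq_zero_of_notMem_tsupport {x : EuclideanSpace ℝ (Fin n)}
    (hx : x ∉ tsupport φ) : divergence φ x = 0 := by
  have h : fderiv ℝ φ x = 0 := by
    by_contra h
    exact hx (support_fderiv_subset ℝ h)
  simp [divergence, h]

theorem IsPerimeterTestField.hasCompactSupport_divergence (hφ : IsPerimeterTestField U φ) :
    HasCompactSupport (divergence φ) :=
  HasCompactSupport.intro hφ.hasCompactSupport fun _ hx => divergence_eq_zero_of_notMem_tsupport hx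

theorem IsPerimeterTestField.integrable_divergence (hφ : IsPerimeterTestField U φ) :
    Integrable (divergence φ) :=
  hφ.continuous_divergence.integrable_of_hasCompactSupport hφ.hasCompactSupport_divergence

theorem lineDeriv_coord (hφ : IsPerimeterTestField U φ) (x v : EuclideanSpace ℝ (Fin n))
    (i : Fin n) : lineDeriv ℝ (fun x => φ x i) x v = fderiv ℝ φ x v i := by
  have hd : DifferentiableAt ℝ φ x := hφ.contDiff.differentiable (by norm_num) x
  have h := ((EuclideanSpace.proj i : EuclideanSpace ℝ (Fin n) →L[ℝ] ℝ).hasFDerivAt.comp x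
    hd.hasFDerivAt).hasLineDerivAt v
  exact h.lineDeriv

/-- Integration by parts against a Lipschitz function. -/
theorem IsPerimeterTestField.integral_mul_divergence (hφ : IsPerimeterTestField U φ)
    {f : EuclideanSpace ℝ (Fin n) → ℝ} {C : NNReal} (hf : LipschitzWith C f) :
    ∫ x, f x * divergence φ x = -∫ x, fderiv ℝ f x (φ x) := by
  have hcs := hφ.hasCompactSupport_coord
  have hlip : ∀ i, ∃ D, LipschitzWith D fun x => φ x i := fun i =>
    (hφ.contDiff_coord i).lipschitzWith_of_hasCompactSupport (hcs i) (by norm_num)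
  have hint1 : ∀ i ∈ Finset.univ, Integrable fun x => f x *
      fderiv ℝ φ x (EuclideanSpace.single i 1) i := by
    intro i _
    have h := hφ.contDiff.continuous_fderiv (by norm_num)
    refine Continuous.integrable_of_hasCompactSupport ?_ ?_
    · exact hf.continuous.mul (by fun_prop)
    · refine HasCompactSupport.mul_left (HasCompactSupport.intro hφ.hasCompactSupport ?_)
      intro x hx
      have h : fderiv ℝ φ x = 0 := by
        by_contra h
        exact hx (support_fderiv_subset ℝ h)
      simp [h]
  have hint2 : ∀ i ∈ Finset.univ, Integrable fun x =>
      lineDeriv ℝ f x (EuclideanSpace.single i 1) * φ x i := by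
    intro i _
    refine Integrable.bdd_mul (c := C * ‖EuclideanSpace.single i (1 : ℝ)‖)
      ((hφ.contDiff_coord i).continuous.integrable_of_hasCompactSupport (hcs i))
      (measurable_lineDeriv hf.continuous).aestronglyMeasurable (Filter.Eventually.of_forall fun x => ?_)
    exact norm_lineDeriv_le_of_lipschitz ℝ hf
  calc ∫ x, f x * divergence φ x
      = ∑ i, ∫ x, f x * fderiv ℝ φ x (EuclideanSpace.single i 1) i := by
        rw [← integral_finsetSum _ hint1]
        simp only [divergence, Finset.mul_sum]
    _ = ∑ i, -∫ x, lineDeriv ℝ f x (EuclideanSpace.single i 1) * φ x i := by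
        refine Finset.sum_congr rfl fun i _ => ?_
        obtain ⟨D, hD⟩ := hlip i
        rw [hf.integral_lineDeriv_mul_eq hD (hcs i), ← integral_neg]
        congr 1
        funext x
        rw [lineDeriv_neg, lineDeriv_coord hφ]
        ring
    _ = -∫ x, fderiv ℝ f x (φ x) := by
        rw [Finset.sum_neg_distrib, ← integral_finsetSum _ hint2]
        congr 1
        refine integral_congr_ae ?_
        -- Rademacher's theorem: almost everywhere the directional derivatives come from a linear
        -- map and can be summed against the coordinates of `φ x`.
        filter_upwards [hf.ae_differentiableAt (μ := volume)] with x hx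
        have hsum : φ x = ∑ i, φ x i • EuclideanSpace.single i (1 : ℝ) := by
          ext j; simp [Finset.sum_apply, Pi.single_apply]
        conv_rhs => rw [hsum, map_sum]
        refine Finset.sum_congr rfl fun i _ => ?_
        rw [hx.lineDeriv_eq_fderiv, map_smul, smul_eq_mul, mul_comm]

theorem IsPerimeterTestField.integral_divergence (hφ : IsPerimeterTestField U φ) :
    ∫ x, divergence φ x = 0 := by
  have h := hφ.integral_mul_divergence (LipschitzWith.const (1 : ℝ))
  simpa using h

theorem IsPerimeterTestField.neg (hφ : IsPerimeterTestField U φ) :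
    IsPerimeterTestField U (fun x => -φ x) where
  contDiff := hφ.contDiff.neg
  hasCompactSupport := hφ.hasCompactSupport.neg
  tsupport_subset := by
    have : tsupport (fun x => -φ x) = tsupport φ := by
      simp [tsupport, Function.support_fun_neg]
    rw [this]; exact hφ.tsupport_subset
  norm_le_one x := by rw [norm_neg]; exact hφ.norm_le_one x

theorem divergence_neg (x : EuclideanSpace ℝ (Fin n)) :
    divergence (fun x => -φ x) x = -divergence φ x := by
  simp [divergence, fderiv_fun_neg]

end TestField

theorem IsPerimeterTestField.divergence_eq_zero {n : ℕ}
    {φ : EuclideanSpace ℝ (Fin n) → EuclideanSpace ℝ (Fin n)}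
    (hφ : IsPerimeterTestField (interior (unitCube n)) φ) {x : EuclideanSpace ℝ (Fin n)}
    (hx : x ∉ unitCube n) : divergence φ x = 0 :=
  divergence_eq_zero_of_notMem_tsupport fun h => hx (interior_subset (hφ.tsupport_subset h))

theorem IsPerimeterTestField.apply_eq_zero {n : ℕ}
    {φ : EuclideanSpace ℝ (Fin n) → EuclideanSpace ℝ (Fin n)}
    (hφ : IsPerimeterTestField (interior (unitCube n)) φ) {x : EuclideanSpace ℝ (Fin n)}
    (hx : x ∉ unitCube n) : φ x = 0 :=
  image_eq_zero_of_notMem_tsupport fun h => hx (interior_subset (hφ.tsupport_subset h))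

theorem IsPerimeterTestField.setIntegral_divergence_inter {n : ℕ}
    {φ : EuclideanSpace ℝ (Fin n) → EuclideanSpace ℝ (Fin n)}
    (hφ : IsPerimeterTestField (interior (unitCube n)) φ) {K : Set (EuclideanSpace ℝ (Fin n))}
    (hK : MeasurableSet K) :
    ∫ x in K ∩ unitCube n, divergence φ x = ∫ x in K, divergence φ x := by
  refine (setIntegral_eq_of_subset_of_forall_sdiff_eq_zero hK inter_subset_left ?_).symm
  exact fun x hx => hφ.divergence_eq_zero fun h => hx.2 ⟨hx.1, h⟩

/-- The complement in the cube has the same perimeter. -/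
theorem cubePerimeter_sdiff {n : ℕ} {E : Set (EuclideanSpace ℝ (Fin n))} (hE : MeasurableSet E)
    (hEQ : E ⊆ unitCube n) : cubePerimeter n (unitCube n \ E) = cubePerimeter n E := by
  have key : ∀ φ, IsPerimeterTestField (interior (unitCube n)) φ →
      ∫ x in unitCube n \ E, divergence φ x = ∫ x in E, divergence (fun x => -φ x) x := by
    intro φ hφ
    -- The field has compact support inside the cube, so the integrals over a set and its complement
    -- cancel; changing the sign of the field exchanges the two suprema.
    have h0 : ∫ x in unitCube n, divergence φ x = 0 := by
      have h := hφ.setIntegral_divergence_inter MeasurableSet.univ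
      rwa [univ_inter, setIntegral_univ, hφ.integral_divergence] at h
    rw [setIntegral_sdiff hE hφ.integrable_divergence.integrableOn hEQ, h0]
    simp [divergence_neg, integral_neg]
  apply le_antisymm
  · refine iSup₂_le fun φ hφ => ?_
    rw [key φ hφ]
    exact le_iSup₂_of_le _ hφ.neg le_rfl
  · refine iSup₂_le fun φ hφ => ?_
    refine le_iSup₂_of_le _ hφ.neg ?_
    rw [key _ hφ.neg]
    simp

/-! ### Upper bound for the perimeter by the outer Minkowski content -/

/-- The part of the cube at positive distance less than `δ` from `K`. -/
def outerShell (n : ℕ) (K : Set (EuclideanSpace ℝ (Fin n))) (δ : ℝ) :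
    Set (EuclideanSpace ℝ (Fin n)) :=
  {x | x ∈ unitCube n ∧ 0 < Metric.infDist x K ∧ Metric.infDist x K < δ}

theorem measurableSet_outerShell (n : ℕ) (K : Set (EuclideanSpace ℝ (Fin n))) (δ : ℝ) :
    MeasurableSet (outerShell n K δ) := by
  have h := (Metric.continuous_infDist_pt K).measurable
  exact (isClosed_unitCube n).measurableSet.inter
    ((measurableSet_lt measurable_const h).inter (measurableSet_lt h measurable_const))

theorem volume_ne_top_of_subset_unitCube {n : ℕ} {A : Set (EuclideanSpace ℝ (Fin n))}
    (hA : A ⊆ unitCube n) : volume A ≠ ∞ :=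
  ne_top_of_le_ne_top (by rw [volume_unitCube]; exact ENNReal.one_ne_top) (measure_mono hA)

theorem outerShell_subset (n : ℕ) (K : Set (EuclideanSpace ℝ (Fin n))) (δ : ℝ) :
    outerShell n K δ ⊆ unitCube n := fun _ hx => hx.1

/-- Replace the indicator of `K` by the tent function `max (1 - dist / δ) 0`. The error lives on the
shell, where the divergence is bounded by `M`. After integration by parts the gradient, of norm at
most `1 / δ`, also lives on the shell. -/
theorem IsPerimeterTestField.setIntegral_divergence_le {n : ℕ}
    {φ : EuclideanSpace ℝ (Fin n) → EuclideanSpace ℝ (Fin n)}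
    (hφ : IsPerimeterTestField (interior (unitCube n)) φ) {K : Set (EuclideanSpace ℝ (Fin n))}
    (hK : IsClosed K) (hne : K.Nonempty) :
    ∃ M : ℝ, ∀ δ > 0, ∫ x in K, divergence φ x ≤ (1 / δ + M) * volume.real (outerShell n K δ) := by
  obtain ⟨M, hM⟩ := hφ.hasCompactSupport_divergence.exists_bound_of_continuous
    hφ.continuous_divergence
  refine ⟨M, fun δ hδ => ?_⟩
  set A := outerShell n K δ with hA
  have hAm : MeasurableSet A := measurableSet_outerShell n K δ
  have hAfin : volume A ≠ ∞ := volume_ne_top_of_subset_unitCube (outerShell_subset n K δ)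
  set f : EuclideanSpace ℝ (Fin n) → ℝ := fun x => max (1 - δ⁻¹ * Metric.infDist x K) 0 with hf
  have hf0 : ∀ x, 0 ≤ f x := fun x => le_max_right _ _
  have hf1 : ∀ x, f x ≤ 1 := fun x => by
    have := Metric.infDist_nonneg (x := x) (s := K)
    exact max_le (by have : 0 ≤ δ⁻¹ * Metric.infDist x K := by positivity
                     linarith) zero_le_one
  have hfz : ∀ x, δ ≤ Metric.infDist x K → f x = 0 := fun x hx => by
    refine max_eq_right ?_
    rw [sub_nonpos, inv_mul_eq_div, one_le_div hδ]
    exact hx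
  have hfK : ∀ x, Metric.infDist x K = 0 → f x = 1 := fun x hx => by simp [hf, hx]
  have hδ' : (0 : ℝ) ≤ δ⁻¹ := (inv_pos.2 hδ).le
  have hlip : LipschitzWith ⟨δ⁻¹, hδ'⟩ f := by
    have h1 : LipschitzWith ⟨δ⁻¹, hδ'⟩ fun x => 1 - δ⁻¹ * Metric.infDist x K := by
      refine LipschitzWith.of_dist_le_mul fun x y => ?_
      have h := (Metric.lipschitz_infDist_pt K).dist_le_mul x y
      rw [Real.dist_eq] at h ⊢
      have e : 1 - δ⁻¹ * Metric.infDist x K - (1 - δ⁻¹ * Metric.infDist y K) =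
          -(δ⁻¹ * (Metric.infDist x K - Metric.infDist y K)) := by ring
      rw [e, abs_neg, abs_mul, abs_of_nonneg hδ']
      simp only [NNReal.coe_one, one_mul] at h
      exact mul_le_mul_of_nonneg_left h hδ'
    exact h1.max_const 0
  have hind : Integrable (A.indicator fun _ => (1 : ℝ)) :=
    (integrable_indicator_iff hAm).2 (integrableOn_const hAfin)
  have hindA : ∀ c : ℝ, ∫ x, c * A.indicator (fun _ => (1 : ℝ)) x = c * volume.real A := by
    intro c
    rw [integral_const_mul, integral_indicator hAm]
    simp
  have hfint : Integrable fun x => f x * divergence φ x :=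
    (hlip.continuous.mul hφ.continuous_divergence).integrable_of_hasCompactSupport
      hφ.hasCompactSupport_divergence.mul_left
  have step1 : ∫ x in K, divergence φ x ≤
      (∫ x, f x * divergence φ x) + M * volume.real A := by
    rw [← hindA, ← integral_add hfint (hind.const_mul M), ← integral_indicator hK.measurableSet]
    refine integral_mono (hφ.integrable_divergence.indicator hK.measurableSet)
      (hfint.add (hind.const_mul M)) fun x => ?_
    have hMx := hM x
    rw [Real.norm_eq_abs, abs_le] at hMx
    have hM0 : 0 ≤ M := by linarith
    have hI : 0 ≤ A.indicator (fun _ => (1 : ℝ)) x := indicator_nonneg (fun _ _ => zero_le_one) x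
    by_cases hxK : x ∈ K
    · simp only [indicator_of_mem hxK, hfK x (Metric.infDist_zero_of_mem hxK), one_mul]
      nlinarith
    · rw [indicator_of_notMem hxK]
      have hpos := (hK.notMem_iff_infDist_pos hne).1 hxK
      by_cases hxQ : x ∈ unitCube n
      · rcases lt_or_ge (Metric.infDist x K) δ with h | h
        · have hxA : x ∈ A := ⟨hxQ, hpos, h⟩
          simp only [indicator_of_mem hxA]
          have := hf0 x
          have := hf1 x
          nlinarith
        · simp only [hfz x h]
          nlinarith
      · simp only [hφ.divergence_eq_zero hxQ]
        nlinarith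
  have step2 : ∫ x, f x * divergence φ x ≤ 1 / δ * volume.real A := by
    rw [hφ.integral_mul_divergence hlip, ← hindA, ← integral_neg]
    by_cases hi : Integrable fun x => -fderiv ℝ f x (φ x)
    · refine integral_mono hi (hind.const_mul _) fun x => ?_
      have hI : 0 ≤ A.indicator (fun _ => (1 : ℝ)) x := indicator_nonneg (fun _ _ => zero_le_one) x
      have hR : 0 ≤ 1 / δ * A.indicator (fun _ => (1 : ℝ)) x := by positivity
      by_cases hxQ : x ∈ unitCube n
      · rcases eq_or_lt_of_le (Metric.infDist_nonneg (x := x) (s := K)) with h0 | h0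
        -- On `K` the tent attains its maximum. `fderiv` vanishes at an extremum even without
        -- differentiability, where its default value is 0; so boundary points need no null-set
        -- argument.
        · have : fderiv ℝ f x = 0 := IsLocalMax.fderiv_eq_zero
            (Filter.Eventually.of_forall fun y => by rw [hfK x h0.symm]; exact hf1 y)
          simpa [this] using hR
        rcases lt_or_ge (Metric.infDist x K) δ with h | h
        · have hxA : x ∈ A := ⟨hxQ, h0, h⟩
          simp only [indicator_of_mem hxA, mul_one]
          calc -fderiv ℝ f x (φ x) ≤ ‖fderiv ℝ f x (φ x)‖ := by
                rw [Real.norm_eq_abs]; exact neg_le_abs _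
            _ ≤ ‖fderiv ℝ f x‖ * ‖φ x‖ := ContinuousLinearMap.le_opNorm _ _
            _ ≤ δ⁻¹ * 1 := by
                gcongr
                · exact norm_fderiv_le_of_lipschitz ℝ hlip
                · exact hφ.norm_le_one x
            _ = 1 / δ := by ring
        · have : fderiv ℝ f x = 0 := IsLocalMin.fderiv_eq_zero
            (Filter.Eventually.of_forall fun y => by rw [hfz x h]; exact hf0 y)
          simpa [this] using hR
      · simpa [hφ.apply_eq_zero hxQ] using hR
    -- Without integrability the integral takes its default value 0, and the bound is trivial.
    · rw [integral_undef hi, hindA]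
      positivity
  calc _ ≤ _ := step1
    _ ≤ 1 / δ * volume.real A + M * volume.real A := by gcongr
    _ = _ := by ring

/-- The relative perimeter is at most the outer Minkowski content. -/
theorem cubePerimeter_le_of_outerShell {n : ℕ} {K : Set (EuclideanSpace ℝ (Fin n))}
    (hK : IsClosed K) (hne : K.Nonempty) {g : ℝ → ℝ} {a : ℝ}
    (hg : ∀ᶠ δ in nhdsWithin 0 (Ioi 0), volume.real (outerShell n K δ) ≤ g δ)
    (ha : Filter.Tendsto (fun δ => g δ / δ) (nhdsWithin 0 (Ioi 0)) (nhds a)) :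
    cubePerimeter n (K ∩ unitCube n) ≤ ENNReal.ofReal a := by
  refine iSup₂_le fun φ hφ => ENNReal.ofReal_le_ofReal ?_
  rw [hφ.setIntegral_divergence_inter hK.measurableSet]
  obtain ⟨M, hM⟩ := hφ.setIntegral_divergence_le hK hne
  have hid : Filter.Tendsto (fun δ : ℝ => 1 + |M| * δ) (nhdsWithin 0 (Ioi 0)) (nhds 1) := by
    have : Filter.Tendsto (fun δ : ℝ => 1 + |M| * δ) (nhds 0) (nhds (1 + |M| * 0)) :=
      Continuous.tendsto (by fun_prop) 0
    rw [mul_zero, add_zero] at this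
    exact this.mono_left nhdsWithin_le_nhds
  have hlim := ha.mul hid
  rw [mul_one] at hlim
  refine ge_of_tendsto hlim ?_
  filter_upwards [hg, self_mem_nhdsWithin] with δ hδ hpos
  have hpos' : (0 : ℝ) < δ := hpos
  calc ∫ x in K, divergence φ x ≤ (1 / δ + M) * volume.real (outerShell n K δ) := hM δ hpos
    _ ≤ (1 / δ + |M|) * volume.real (outerShell n K δ) := by gcongr; exact le_abs_self M
    _ ≤ (1 / δ + |M|) * g δ := by gcongr
    _ = g δ / δ * (1 + |M| * δ) := by field_simp

/-! ### Lower bound for the perimeter of tubes by a radial field -/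

theorem deriv_smoothTransition_bounded : ∃ C : ℝ, ∀ x, |deriv Real.smoothTransition x| ≤ C := by
  have hcont : Continuous (deriv Real.smoothTransition) :=
    (Real.smoothTransition.contDiff (n := 1)).continuous_deriv (by norm_num)
  obtain ⟨C, hC⟩ := (isCompact_Icc (a := (0 : ℝ)) (b := 1)).exists_bound_of_continuousOn
    hcont.continuousOn
  have hC0 : 0 ≤ C := (norm_nonneg _).trans (hC 0 (by simp))
  refine ⟨C, fun x => ?_⟩
  by_cases hx : x ∈ Icc (0 : ℝ) 1
  · exact hC x hx
  · rw [mem_Icc, not_and_or, not_le, not_le] at hx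
    have h0 : deriv Real.smoothTransition x = 0 := by
      rcases hx with hx | hx
      · refine IsLocalMin.deriv_eq_zero (Filter.Eventually.of_forall fun y => ?_)
        rw [Real.smoothTransition.zero_of_nonpos hx.le]
        exact Real.smoothTransition.nonneg y
      · refine IsLocalMax.deriv_eq_zero (Filter.Eventually.of_forall fun y => ?_)
        rw [Real.smoothTransition.one_of_one_le hx.le]
        exact Real.smoothTransition.le_one y
    rw [h0, abs_zero]; exact hC0

/-- A smooth cutoff on the unit interval: `0` outside `[δ, 1 - δ]` and `1` on `[2δ, 1 - 2δ]`. -/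
noncomputable def intervalCutoff (δ t : ℝ) : ℝ :=
  Real.smoothTransition (t / δ - 1) * Real.smoothTransition ((1 - t) / δ - 1)

section intervalCutoff

variable {δ : ℝ}

theorem intervalCutoff_nonneg (δ t : ℝ) : 0 ≤ intervalCutoff δ t :=
  mul_nonneg (Real.smoothTransition.nonneg _) (Real.smoothTransition.nonneg _)

theorem intervalCutoff_le_one (δ t : ℝ) : intervalCutoff δ t ≤ 1 :=
  mul_le_one₀ (Real.smoothTransition.le_one _) (Real.smoothTransition.nonneg _)
    (Real.smoothTransition.le_one _)

theorem intervalCutoff_eq_zero (hδ : 0 < δ) {t : ℝ} (ht : t ∉ Icc δ (1 - δ)) :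
    intervalCutoff δ t = 0 := by
  rw [mem_Icc, not_and_or, not_le, not_le] at ht
  rcases ht with h | h
  · rw [intervalCutoff, Real.smoothTransition.zero_of_nonpos, zero_mul]
    rw [sub_nonpos, div_le_one hδ]; exact h.le
  · rw [intervalCutoff, mul_comm, Real.smoothTransition.zero_of_nonpos, zero_mul]
    rw [sub_nonpos, div_le_one hδ]; linarith

theorem intervalCutoff_eq_one (hδ : 0 < δ) {t : ℝ} (ht : t ∈ Icc (2 * δ) (1 - 2 * δ)) :
    intervalCutoff δ t = 1 := by
  rw [intervalCutoff, Real.smoothTransition.one_of_one_le, Real.smoothTransition.one_of_one_le,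
    one_mul]
  · have h := (le_div_iff₀ hδ).2 (show 2 * δ ≤ 1 - t by linarith [ht.2]); linarith
  · have h := (le_div_iff₀ hδ).2 ht.1; linarith

theorem contDiff_intervalCutoff (δ : ℝ) : ContDiff ℝ 1 (intervalCutoff δ) := by
  have h := Real.smoothTransition.contDiff (n := 1)
  exact (h.comp (by fun_prop)).mul (h.comp (by fun_prop))

theorem deriv_intervalCutoff_eq_zero (hδ : 0 < δ) {t : ℝ} (ht : t ∈ Icc (2 * δ) (1 - 2 * δ)) :
    deriv (intervalCutoff δ) t = 0 := by
  refine IsLocalMax.deriv_eq_zero (Filter.Eventually.of_forall fun y => ?_)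
  rw [intervalCutoff_eq_one hδ ht]
  exact intervalCutoff_le_one δ y

theorem abs_deriv_intervalCutoff_le {C : ℝ} (hC : ∀ x, |deriv Real.smoothTransition x| ≤ C)
    (hδ : 0 < δ) (t : ℝ) : |deriv (intervalCutoff δ) t| ≤ 2 * C / δ := by
  have hs : Differentiable ℝ Real.smoothTransition :=
    (Real.smoothTransition.contDiff (n := 1)).differentiable (by norm_num)
  have h1 : HasDerivAt (fun t : ℝ => t / δ - 1) (1 / δ) t :=
    ((hasDerivAt_id t).div_const δ).sub_const 1
  have h2 : HasDerivAt (fun t : ℝ => (1 - t) / δ - 1) (-1 / δ) t :=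
    (((hasDerivAt_id t).const_sub 1).div_const δ).sub_const 1
  have h := ((hs _).hasDerivAt.comp t h1).mul ((hs _).hasDerivAt.comp t h2)
  have h' : deriv (intervalCutoff δ) t = _ := h.deriv
  rw [h']
  simp only [Function.comp]
  have b : ∀ x, |Real.smoothTransition x| ≤ 1 := fun x => by
    rw [abs_of_nonneg (Real.smoothTransition.nonneg x)]; exact Real.smoothTransition.le_one x
  have hC0 : 0 ≤ C := (abs_nonneg _).trans (hC 0)
  refine (abs_add_le _ _).trans ?_
  simp only [abs_mul, abs_div, abs_neg, abs_one, abs_of_pos hδ]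
  have e1 := mul_le_mul (mul_le_mul_of_nonneg_right (hC (t / δ - 1)) (by positivity : 0 ≤ 1 / δ))
    (b ((1 - t) / δ - 1)) (abs_nonneg _) (by positivity)
  have e2 := mul_le_mul (b (t / δ - 1)) (mul_le_mul_of_nonneg_right (hC ((1 - t) / δ - 1))
    (by positivity : 0 ≤ 1 / δ)) (by positivity) zero_le_one
  calc _ ≤ C * (1 / δ) * 1 + 1 * (C * (1 / δ)) := add_le_add e1 e2
    _ = 2 * C / δ := by ring

end intervalCutoff

/-- The radial field around the face `{x i = ε i, i ∈ S}`, of norm `≤ 1`, cut off near the boundary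
of the cube and away from the cylinder of radius `√((r² + R²) / 2)`. -/
noncomputable def radialField (n : ℕ) (S : Finset (Fin n)) (ε : Fin n → ℝ) (r R δ : ℝ)
    (x : EuclideanSpace ℝ (Fin n)) : EuclideanSpace ℝ (Fin n) :=
  WithLp.toLp 2 fun i => if i ∈ S then
    1 / R * (x i - ε i) * (∏ j, intervalCutoff δ (x j)) *
      Real.smoothTransition ((R ^ 2 - ∑ j ∈ S, (x j - ε j) ^ 2) / ((R ^ 2 - r ^ 2) / 2)) else 0

section radialField

variable {n : ℕ} {S : Finset (Fin n)} {ε : Fin n → ℝ} {r R δ : ℝ}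

theorem prod_intervalCutoff_nonneg {ι : Type*} (s : Finset ι) (δ : ℝ) (x : ι → ℝ) :
    0 ≤ ∏ j ∈ s, intervalCutoff δ (x j) :=
  Finset.prod_nonneg fun _ _ => intervalCutoff_nonneg _ _

theorem prod_intervalCutoff_le_one {ι : Type*} (s : Finset ι) (δ : ℝ) (x : ι → ℝ) :
    ∏ j ∈ s, intervalCutoff δ (x j) ≤ 1 :=
  Finset.prod_le_one (fun _ _ => intervalCutoff_nonneg _ _) fun _ _ => intervalCutoff_le_one _ _

theorem isPerimeterTestField_radialField (hr : 0 < r) (hrR : r < R) (hδ : 0 < δ) :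
    IsPerimeterTestField (interior (unitCube n)) (radialField n S ε r R δ) := by
  have hsub : tsupport (radialField n S ε r R δ) ⊆
      {x | ∀ i, x i ∈ Icc δ (1 - δ)} := by
    refine closure_minimal (fun x hx => ?_) ?_
    · by_contra h
      rw [mem_ofPred_eq, not_forall] at h
      obtain ⟨i, hi⟩ := h
      apply hx
      have h0 : ∏ j, intervalCutoff δ (x j) = 0 :=
        Finset.prod_eq_zero (Finset.mem_univ i) (intervalCutoff_eq_zero hδ hi)
      ext j
      simp [radialField, h0]
    · simp only [ofPred_forall]
      exact isClosed_iInter fun i => isClosed_Icc.preimage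
        (show Continuous fun x : EuclideanSpace ℝ (Fin n) => x i by fun_prop)
  have hsub' : {x : EuclideanSpace ℝ (Fin n) | ∀ i, x i ∈ Icc δ (1 - δ)} ⊆
      interior (unitCube n) := by
    have hopen : IsOpen {x : EuclideanSpace ℝ (Fin n) | ∀ i, x i ∈ Ioo (0 : ℝ) 1} := by
      simp only [ofPred_forall]
      exact isOpen_iInter_of_finite fun i => isOpen_Ioo.preimage
        (show Continuous fun x : EuclideanSpace ℝ (Fin n) => x i by fun_prop)
    refine subset_trans ?_ (interior_maximal (t := {x | ∀ i, x i ∈ Ioo (0 : ℝ) 1})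
      (fun x hx i => Ioo_subset_Icc_self (hx i)) hopen)
    intro x hx i
    exact ⟨by linarith [(hx i).1], by linarith [(hx i).2]⟩
  refine ⟨?_, ?_, hsub.trans hsub', fun x => ?_⟩
  · rw [contDiff_euclidean]
    intro i
    by_cases hi : i ∈ S
    · simp only [radialField, hi, if_true]
      have h1 : ContDiff ℝ 1 fun x : EuclideanSpace ℝ (Fin n) =>
          ∏ j, intervalCutoff δ (x j) :=
        contDiff_prod fun j _ => (contDiff_intervalCutoff δ).comp (by fun_prop)
      have h2 : ContDiff ℝ 1 fun x : EuclideanSpace ℝ (Fin n) => Real.smoothTransition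
          ((R ^ 2 - ∑ j ∈ S, (x j - ε j) ^ 2) / ((R ^ 2 - r ^ 2) / 2)) :=
        (Real.smoothTransition.contDiff (n := 1)).comp (by fun_prop)
      fun_prop
    · simp only [radialField, hi, if_false]
      exact contDiff_const
  · exact (isCompact_unitCube n).of_isClosed_subset (isClosed_tsupport _)
      ((hsub.trans hsub').trans interior_subset)
  · have hR : 0 < R := hr.trans hrR
    have hD : 0 < (R ^ 2 - r ^ 2) / 2 := by nlinarith
    set χ := ∏ j, intervalCutoff δ (x j) with hχ
    have hχ0 : 0 ≤ χ := prod_intervalCutoff_nonneg _ _ _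
    have hχ1 : χ ≤ 1 := prod_intervalCutoff_le_one _ _ _
    set q := ∑ j ∈ S, (x j - ε j) ^ 2 with hq
    have hq0 : 0 ≤ q := Finset.sum_nonneg fun _ _ => sq_nonneg _
    set T := Real.smoothTransition ((R ^ 2 - q) / ((R ^ 2 - r ^ 2) / 2)) with hT
    have hT0 : 0 ≤ T := Real.smoothTransition.nonneg _
    have hT1 : T ≤ 1 := Real.smoothTransition.le_one _
    have hsq : ‖radialField n S ε r R δ x‖ ^ 2 = (q / R ^ 2) * T ^ 2 * χ ^ 2 := by
      rw [EuclideanSpace.norm_sq_eq, ← Finset.sum_subset (Finset.subset_univ S), hq,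
        Finset.sum_div, Finset.sum_mul, Finset.sum_mul]
      · refine Finset.sum_congr rfl fun i hi => ?_
        simp only [radialField, hi, if_true, Real.norm_eq_abs, sq_abs, ← hχ, ← hT, ← hq]
        ring
      · intro i _ hi
        simp [radialField, hi]
    have hle : ‖radialField n S ε r R δ x‖ ^ 2 ≤ 1 := by
      rw [hsq]
      -- The linear field divided by `R` has norm at most one inside the cylinder of radius `R`, and
      -- the cutoff `T` vanishes outside it.
      have h1 : (q / R ^ 2) * T ^ 2 ≤ 1 := by
        rcases le_or_gt q (R ^ 2) with h | h
        · exact mul_le_one₀ ((div_le_one (by positivity)).2 h) (by positivity)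
            (pow_le_one₀ hT0 hT1)
        · have : T = 0 := Real.smoothTransition.zero_of_nonpos
            (div_nonpos_of_nonpos_of_nonneg (by linarith) hD.le)
          rw [this]; norm_num
      exact mul_le_one₀ h1 (by positivity) (pow_le_one₀ hχ0 hχ1)
    exact (sq_le_one_iff₀ (norm_nonneg _)).1 hle

theorem divergence_radialField (hr : 0 < r) (hrR : r < R) (hδ : 0 < δ)
    {x : EuclideanSpace ℝ (Fin n)} (hx : ∑ i ∈ S, (x i - ε i) ^ 2 ≤ r ^ 2) :
    divergence (radialField n S ε r R δ) x =
      1 / R * ∑ i ∈ S, ((∏ j, intervalCutoff δ (x j)) +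
        (x i - ε i) * deriv (intervalCutoff δ) (x i) *
          ∏ j ∈ Finset.univ.erase i, intervalCutoff δ (x j)) := by
  have hφ := isPerimeterTestField_radialField (n := n) (S := S) (ε := ε) hr hrR hδ
  have hD : 0 < (R ^ 2 - r ^ 2) / 2 := by nlinarith
  rw [divergence, ← Finset.sum_subset (Finset.subset_univ S), Finset.mul_sum]
  · refine Finset.sum_congr rfl fun i hi => ?_
    rw [← lineDeriv_coord hφ]
    set P := ∏ j ∈ Finset.univ.erase i, intervalCutoff δ (x j) with hP
    -- The cutoff `T` equals one wherever the squared radius is below `(R ^ 2 + r ^ 2) / 2`, hence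
    -- on a whole neighborhood of `x`, and drops out of the derivative.
    have hev : (fun t : ℝ => radialField n S ε r R δ (x + t • EuclideanSpace.single i 1) i)
        =ᶠ[nhds 0] fun t => 1 / R * (x i + t - ε i) * (intervalCutoff δ (x i + t) * P) := by
      have hc : Continuous fun t : ℝ =>
          ∑ j ∈ S, ((x + t • EuclideanSpace.single i (1 : ℝ)) j - ε j) ^ 2 := by fun_prop
      have h0 : ∑ j ∈ S, ((x + (0 : ℝ) • EuclideanSpace.single i (1 : ℝ)) j - ε j) ^ 2 <
          (R ^ 2 + r ^ 2) / 2 := by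
        simp only [zero_smul, add_zero]; nlinarith
      filter_upwards [hc.continuousAt.eventually (gt_mem_nhds h0)] with t ht
      have hT : Real.smoothTransition ((R ^ 2 - ∑ j ∈ S,
          ((x + t • EuclideanSpace.single i (1 : ℝ)) j - ε j) ^ 2) / ((R ^ 2 - r ^ 2) / 2)) = 1 := by
        refine Real.smoothTransition.one_of_one_le ?_
        rw [one_le_div hD]; linarith
      have hprod : ∏ j, intervalCutoff δ ((x + t • EuclideanSpace.single i (1 : ℝ)) j) =
          intervalCutoff δ (x i + t) * P := by
        rw [← Finset.mul_prod_erase _ _ (Finset.mem_univ i)]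
        congr 1
        · simp
        · refine Finset.prod_congr rfl fun j hj => ?_
          simp [Finset.ne_of_mem_erase hj]
      simp only [radialField, hi, if_true]
      rw [hT, hprod]
      simp
    rw [lineDeriv, hev.deriv_eq]
    have hκ : HasDerivAt (fun t => intervalCutoff δ (x i + t)) (deriv (intervalCutoff δ) (x i)) 0 := by
      have h1 : HasDerivAt (intervalCutoff δ) (deriv (intervalCutoff δ) (x i)) (x i + 0) := by
        rw [add_zero]
        exact ((contDiff_intervalCutoff δ).differentiable (by norm_num) _).hasDerivAt
      exact h1.comp_const_add (x i) 0
    have hlin : HasDerivAt (fun t : ℝ => 1 / R * (x i + t - ε i)) (1 / R * 1) 0 :=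
      (((hasDerivAt_id (0 : ℝ)).const_add (x i)).sub_const (ε i)).const_mul _
    have hd : deriv (fun t => 1 / R * (x i + t - ε i) * (intervalCutoff δ (x i + t) * P)) 0 = _ :=
      (hlin.mul (hκ.mul_const P)).deriv
    rw [hd, ← Finset.mul_prod_erase _ _ (Finset.mem_univ i), ← hP]
    simp only [add_zero]
    ring
  · intro i _ hi
    rw [← lineDeriv_coord hφ]
    simp only [radialField, hi, if_false]
    simp [lineDeriv]

end radialField

/-- The points of the cube within `2δ` of its boundary. -/
def boundaryLayer (n : ℕ) (δ : ℝ) : Set (EuclideanSpace ℝ (Fin n)) :=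
  unitCube n \ {x | ∀ i, x i ∈ Icc (2 * δ) (1 - 2 * δ)}

theorem measurableSet_box {n : ℕ} (a b : Fin n → ℝ) :
    MeasurableSet {x : EuclideanSpace ℝ (Fin n) | ∀ i, x i ∈ Icc (a i) (b i)} := by
  simp only [ofPred_forall]
  exact MeasurableSet.iInter fun i => measurableSet_Icc.preimage
    (show Measurable fun x : EuclideanSpace ℝ (Fin n) => x i by fun_prop)

theorem tendsto_volume_boundaryLayer (n : ℕ) :
    Filter.Tendsto (fun δ => volume.real (boundaryLayer n δ)) (nhdsWithin 0 (Ioi 0)) (nhds 0) := by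
  have h : Filter.Tendsto (fun δ : ℝ => 1 - (1 - 4 * δ) ^ n) (nhdsWithin 0 (Ioi 0)) (nhds 0) := by
    have : Filter.Tendsto (fun δ : ℝ => 1 - (1 - 4 * δ) ^ n) (nhds 0)
        (nhds (1 - (1 - 4 * 0) ^ n)) := Continuous.tendsto (by fun_prop) 0
    simp only [mul_zero, sub_zero, one_pow, sub_self] at this
    exact this.mono_left nhdsWithin_le_nhds
  refine h.congr' ?_
  have hlt : ∀ᶠ δ : ℝ in nhdsWithin 0 (Ioi 0), δ < 1 / 4 :=
    nhdsWithin_le_nhds (gt_mem_nhds (by norm_num))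
  filter_upwards [hlt, self_mem_nhdsWithin] with δ hδ hpos
  have hpos' : (0 : ℝ) < δ := hpos
  have hbox := volume_preimage_ofLp_pi (n := n) (fun _ => 2 * δ) (fun _ => 1 - 2 * δ)
  have hsub : {x : EuclideanSpace ℝ (Fin n) | ∀ i, x i ∈ Icc (2 * δ) (1 - 2 * δ)} ⊆ unitCube n :=
    fun x hx i => ⟨by linarith [(hx i).1], by linarith [(hx i).2]⟩
  rw [boundaryLayer, measureReal_sdiff hsub (measurableSet_box _ _)
    (volume_ne_top_of_subset_unitCube subset_rfl), measureReal_def, measureReal_def, hbox,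
    volume_unitCube, Finset.prod_const, Finset.card_univ, Fintype.card_fin, ENNReal.toReal_pow,
    ENNReal.toReal_ofReal (by linarith), ENNReal.toReal_one]
  ring

/-- The part of `E` close to the wall opposite to `{x i = ε i}`. -/
def oppositeCap {n : ℕ} (E : Set (EuclideanSpace ℝ (Fin n))) (ε : Fin n → ℝ) (i : Fin n) (δ : ℝ) :
    Set (EuclideanSpace ℝ (Fin n)) :=
  E ∩ {x | 1 - 2 * δ ≤ |x i - ε i|}

theorem measurableSet_oppositeCap {n : ℕ} {E : Set (EuclideanSpace ℝ (Fin n))}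
    (hE : MeasurableSet E) (ε : Fin n → ℝ) (i : Fin n) (δ : ℝ) :
    MeasurableSet (oppositeCap E ε i δ) :=
  hE.inter (measurableSet_le measurable_const
    (show Measurable fun x : EuclideanSpace ℝ (Fin n) => |x i - ε i| by fun_prop))

/-- Off the boundary layer the divergence is `S.card / R`. Near a wall `x i = ε i` the cutoff has
slope of order `1 / δ`, but the field component is only of order `δ`, so the error is bounded. Walls
with normal outside `S` are parallel to the field. A loss of order `1 / δ` occurs only near opposite
walls, in the caps. -/
theorem divergence_radialField_ge {n : ℕ} {S : Finset (Fin n)} {ε : Fin n → ℝ}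
    (hε : ∀ i, ε i = 0 ∨ ε i = 1) {r R δ C : ℝ} (hr : 0 < r) (hrR : r < R) (hδ : 0 < δ)
    (hC : ∀ x, |deriv Real.smoothTransition x| ≤ C) {x : EuclideanSpace ℝ (Fin n)}
    (hx : x ∈ faceTube n S ε r) :
    1 / R * (S.card - S.card * (1 + 4 * C) * (boundaryLayer n δ).indicator (fun _ => (1 : ℝ)) x -
      2 * C / δ * ∑ i ∈ S, (oppositeCap (faceTube n S ε r) ε i δ).indicator (fun _ => (1 : ℝ)) x) ≤
      divergence (radialField n S ε r R δ) x := by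
  have hR : 0 < R := hr.trans hrR
  have hC0 : 0 ≤ C := (abs_nonneg _).trans (hC 0)
  rw [divergence_radialField hr hrR hδ hx.2]
  refine mul_le_mul_of_nonneg_left ?_ (by positivity)
  set b := (boundaryLayer n δ).indicator (fun _ => (1 : ℝ)) x with hb
  have hb0 : 0 ≤ b := indicator_nonneg (fun _ _ => zero_le_one) x
  have hsum : (S.card : ℝ) - S.card * (1 + 4 * C) * b - 2 * C / δ *
      ∑ i ∈ S, (oppositeCap (faceTube n S ε r) ε i δ).indicator (fun _ => (1 : ℝ)) x =
      ∑ i ∈ S, (1 - (1 + 4 * C) * b - 2 * C / δ *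
        (oppositeCap (faceTube n S ε r) ε i δ).indicator (fun _ => (1 : ℝ)) x) := by
    simp only [Finset.sum_sub_distrib, Finset.sum_const, ← Finset.mul_sum, nsmul_eq_mul]
    ring
  rw [hsum]
  refine Finset.sum_le_sum fun i hi => ?_
  set c := (oppositeCap (faceTube n S ε r) ε i δ).indicator (fun _ => (1 : ℝ)) x with hc
  have hc0 : 0 ≤ c := indicator_nonneg (fun _ _ => zero_le_one) x
  have hcc : 0 ≤ 2 * C / δ * c := by positivity
  set χ := ∏ j, intervalCutoff δ (x j) with hχ
  have hχ0 : 0 ≤ χ := prod_intervalCutoff_nonneg _ _ _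
  set P := ∏ j ∈ Finset.univ.erase i, intervalCutoff δ (x j) with hP
  have hP0 : 0 ≤ P := prod_intervalCutoff_nonneg _ _ _
  have hP1 : P ≤ 1 := prod_intervalCutoff_le_one _ _ _
  have hu1 : |x i - ε i| ≤ 1 := by
    have h1 := (hx.1 i).1
    have h2 := (hx.1 i).2
    rw [abs_le]
    rcases hε i with h | h <;> rw [h] <;> constructor <;> linarith
  have hder := abs_deriv_intervalCutoff_le hC hδ (x i)
  have hterm : ∀ B, |x i - ε i| * |deriv (intervalCutoff δ) (x i)| ≤ B →
      -B ≤ (x i - ε i) * deriv (intervalCutoff δ) (x i) * P := by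
    intro B hB
    have h1 : |(x i - ε i) * deriv (intervalCutoff δ) (x i) * P| ≤ B := by
      rw [abs_mul, abs_mul, abs_of_nonneg hP0]
      exact (mul_le_of_le_one_right (by positivity) hP1).trans hB
    linarith [neg_le_of_abs_le h1]
  by_cases hxb : x ∈ boundaryLayer n δ
  · have hb1 : b = 1 := indicator_of_mem hxb _
    rw [hb1]
    by_cases hcap : x ∈ oppositeCap (faceTube n S ε r) ε i δ
    · have hc1 : c = 1 := indicator_of_mem hcap _
      rw [hc1]
      have h := hterm (2 * C / δ) ((mul_le_mul hu1 hder (abs_nonneg _) zero_le_one).trans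
        (one_mul _).le)
      linarith
    · have hlt : |x i - ε i| < 1 - 2 * δ := by
        by_contra hge
        exact hcap ⟨hx, not_lt.1 hge⟩
      -- Either the point is within `2 * δ` of its own wall, where slope `2 * C / δ` times distance
      -- `2 * δ` gives `4 * C`, or the cutoff in coordinate `i` is locally flat.
      have h := hterm (4 * C) (by
        rcases le_or_gt |x i - ε i| (2 * δ) with h | h
        · calc _ ≤ 2 * δ * (2 * C / δ) := mul_le_mul h hder (abs_nonneg _) (by positivity)
            _ = 4 * C := by field_simp; ring
        · have hmem : x i ∈ Icc (2 * δ) (1 - 2 * δ) := by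
            have h1 := (hx.1 i).1
            have h2 := (hx.1 i).2
            rcases hε i with h' | h' <;> rw [h'] at h hlt
            · rw [sub_zero, abs_of_nonneg h1] at h hlt
              exact ⟨h.le, hlt.le⟩
            · rw [abs_of_nonpos (by linarith)] at h hlt
              constructor <;> linarith
          rw [deriv_intervalCutoff_eq_zero hδ hmem, abs_zero, mul_zero]
          positivity)
      linarith
  · have hmem : ∀ j, x j ∈ Icc (2 * δ) (1 - 2 * δ) := by
      by_contra h
      exact hxb ⟨hx.1, h⟩
    have hχ1 : χ = 1 := Finset.prod_eq_one fun j _ => intervalCutoff_eq_one hδ (hmem j)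
    rw [hχ1, deriv_intervalCutoff_eq_zero hδ (hmem i)]
    have : 0 ≤ (1 + 4 * C) * b := by positivity
    linarith

/-- Test with the radial field, let `δ → 0` at fixed `R > r`, then let `R` decrease to `r`. The
boundary layer has vanishing volume, and the hypothesis says that the caps have volume `o(δ)`, which
absorbs the slope `1 / δ`. -/
theorem le_cubePerimeter_faceTube_of_tendsto {n : ℕ} {S : Finset (Fin n)} {ε : Fin n → ℝ}
    (hε : ∀ i, ε i = 0 ∨ ε i = 1) {r : ℝ} (hr : 0 < r)
    (hcap : ∀ i ∈ S, Filter.Tendsto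
      (fun δ => volume.real (oppositeCap (faceTube n S ε r) ε i δ) / δ)
      (nhdsWithin 0 (Ioi 0)) (nhds 0)) :
    ENNReal.ofReal (S.card * volume.real (faceTube n S ε r) / r) ≤
      cubePerimeter n (faceTube n S ε r) := by
  set E := faceTube n S ε r with hE
  have hEQ : E ⊆ unitCube n := fun x hx => hx.1
  have hEm : MeasurableSet E := (isClosed_faceTube n S ε r).measurableSet
  have hEfin : volume E ≠ ∞ := volume_ne_top_of_subset_unitCube hEQ
  obtain ⟨C, hC⟩ := deriv_smoothTransition_bounded
  have hC0 : 0 ≤ C := (abs_nonneg _).trans (hC 0)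
  have hbound : ∀ R > r, ∀ δ > 0, ENNReal.ofReal (1 / R * (S.card * volume.real E -
      S.card * (1 + 4 * C) * volume.real (boundaryLayer n δ) -
      2 * C * ∑ i ∈ S, volume.real (oppositeCap E ε i δ) / δ)) ≤ cubePerimeter n E := by
    intro R hR δ hδ
    have hR0 : 0 < R := hr.trans hR
    have hφ := isPerimeterTestField_radialField (n := n) (S := S) (ε := ε) hr hR hδ
    refine le_iSup₂_of_le _ hφ (ENNReal.ofReal_le_ofReal ?_)
    have hBm : MeasurableSet (boundaryLayer n δ) :=
      (isClosed_unitCube n).measurableSet.diff (measurableSet_box _ _)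
    have hind : ∀ A : Set (EuclideanSpace ℝ (Fin n)), MeasurableSet A →
        IntegrableOn (A.indicator fun _ => (1 : ℝ)) E := fun A hA =>
      (integrableOn_const (C := (1 : ℝ)) hEfin).indicator hA
    have hval : ∀ A : Set (EuclideanSpace ℝ (Fin n)), MeasurableSet A →
        ∫ x in E, A.indicator (fun _ => (1 : ℝ)) x = volume.real (E ∩ A) := by
      intro A hA
      rw [setIntegral_indicator hA]; simp
    have hsumi : IntegrableOn (fun x => ∑ i ∈ S,
        (oppositeCap E ε i δ).indicator (fun _ => (1 : ℝ)) x) E :=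
      integrable_finsetSum _ fun i _ => hind _ (measurableSet_oppositeCap hEm ε i δ)
    have hconst : IntegrableOn (fun _ => (S.card : ℝ)) E := integrableOn_const hEfin
    have hdiff : IntegrableOn (fun x => (S.card : ℝ) - S.card * (1 + 4 * C) *
        (boundaryLayer n δ).indicator (fun _ => (1 : ℝ)) x) E :=
      hconst.sub ((hind _ hBm).const_mul (S.card * (1 + 4 * C)))
    have hdiff' : IntegrableOn (fun x => (S.card : ℝ) - S.card * (1 + 4 * C) *
        (boundaryLayer n δ).indicator (fun _ => (1 : ℝ)) x - 2 * C / δ *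
          ∑ i ∈ S, (oppositeCap E ε i δ).indicator (fun _ => (1 : ℝ)) x) E :=
      hdiff.sub (hsumi.const_mul (2 * C / δ))
    have hI := setIntegral_mono_on (μ := volume) (s := E) (hdiff'.const_mul (1 / R))
      hφ.integrable_divergence.integrableOn hEm
      (fun x hx => divergence_radialField_ge hε hr hR hδ hC hx)
    refine le_trans ?_ hI
    have e1 : ∫ x in E, 1 / R * ((S.card : ℝ) - S.card * (1 + 4 * C) *
        (boundaryLayer n δ).indicator (fun _ => (1 : ℝ)) x - 2 * C / δ *
          ∑ i ∈ S, (oppositeCap E ε i δ).indicator (fun _ => (1 : ℝ)) x) =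
        1 / R * (S.card * volume.real E - S.card * (1 + 4 * C) *
          volume.real (E ∩ boundaryLayer n δ) -
          2 * C / δ * ∑ i ∈ S, volume.real (E ∩ oppositeCap E ε i δ)) := by
      rw [integral_const_mul, integral_sub hdiff (hsumi.const_mul (2 * C / δ)),
        integral_sub hconst ((hind _ hBm).const_mul (S.card * (1 + 4 * C))), integral_const_mul,
        integral_const_mul, hval _ hBm, integral_finsetSum _ fun i _ =>
          hind _ (measurableSet_oppositeCap hEm ε i δ),
        Finset.sum_congr rfl fun i _ => hval _ (measurableSet_oppositeCap hEm ε i δ)]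
      simp [mul_comm]
    rw [e1]
    refine mul_le_mul_of_nonneg_left ?_ (by positivity)
    have h1 : volume.real (E ∩ boundaryLayer n δ) ≤ volume.real (boundaryLayer n δ) :=
      measureReal_mono inter_subset_right
        (volume_ne_top_of_subset_unitCube sdiff_subset)
    have h2 : 2 * C / δ * ∑ i ∈ S, volume.real (E ∩ oppositeCap E ε i δ) =
        2 * C * ∑ i ∈ S, volume.real (oppositeCap E ε i δ) / δ := by
      rw [← Finset.sum_div, Finset.sum_congr rfl fun i _ => by
        rw [inter_eq_self_of_subset_right (show oppositeCap E ε i δ ⊆ E from inter_subset_left)]]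
      ring
    rw [h2]
    have h3 := mul_le_mul_of_nonneg_left h1 (show 0 ≤ (S.card : ℝ) * (1 + 4 * C) by positivity)
    linarith
  have hboundR : ∀ R > r, ENNReal.ofReal (1 / R * (S.card * volume.real E)) ≤
      cubePerimeter n E := by
    intro R hR
    have hsum := tendsto_finsetSum S hcap
    have h := ((((tendsto_volume_boundaryLayer n).const_mul ((S.card : ℝ) * (1 + 4 * C))).const_sub
      (S.card * volume.real E)).sub (hsum.const_mul (2 * C))).const_mul (1 / R)
    simp only [Finset.sum_const_zero, mul_zero, sub_zero] at h
    refine le_of_tendsto (ENNReal.tendsto_ofReal h) ?_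
    filter_upwards [self_mem_nhdsWithin] with δ hδ
    exact hbound R hR δ hδ
  have hlim : Filter.Tendsto (fun R => ENNReal.ofReal (1 / R * (S.card * volume.real E)))
      (nhdsWithin r (Ioi r)) (nhds (ENNReal.ofReal (1 / r * (S.card * volume.real E)))) := by
    refine ENNReal.tendsto_ofReal (Filter.Tendsto.mul_const _ ?_)
    have h : ContinuousAt (fun R : ℝ => 1 / R) r := by
      refine continuousAt_const.div continuousAt_id hr.ne'
    exact h.tendsto.mono_left nhdsWithin_le_nhds
  have e : (S.card * volume.real E / r : ℝ) = 1 / r * (S.card * volume.real E) := by ring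
  rw [e]
  refine le_of_tendsto hlim ?_
  filter_upwards [self_mem_nhdsWithin] with R hR
  exact hboundR R hR

/-- A tube of radius below one keeps a positive distance from the opposite walls, so the caps are
empty for small `δ`. -/
theorem le_cubePerimeter_faceTube_of_lt_one {n : ℕ} {S : Finset (Fin n)} {ε : Fin n → ℝ}
    (hε : ∀ i, ε i = 0 ∨ ε i = 1) {r : ℝ} (hr : 0 < r) (hr1 : r < 1) :
    ENNReal.ofReal (S.card * volume.real (faceTube n S ε r) / r) ≤
      cubePerimeter n (faceTube n S ε r) := by
  refine le_cubePerimeter_faceTube_of_tendsto hε hr fun i hi => ?_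
  refine tendsto_const_nhds.congr' ?_
  have hlt : ∀ᶠ δ : ℝ in nhdsWithin 0 (Ioi 0), δ < (1 - r) / 2 :=
    nhdsWithin_le_nhds (gt_mem_nhds (by linarith))
  filter_upwards [hlt] with δ hδ
  have : oppositeCap (faceTube n S ε r) ε i δ = ∅ := by
    refine eq_empty_of_forall_notMem ?_
    rintro x ⟨hx, hx'⟩
    have h1 : (x i - ε i) ^ 2 ≤ r ^ 2 := (Finset.single_le_sum
      (f := fun i => (x i - ε i) ^ 2) (fun i _ => sq_nonneg _) hi).trans hx.2
    have h2 := abs_le_of_sq_le_sq h1 hr.le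
    have h3 : 1 - 2 * δ ≤ |x i - ε i| := hx'
    linarith
  rw [this]; simp

/-- Tangency at the opposite wall: `|x i - ε i| ≥ 1 - 2 * δ` leaves at most `1 - (1 - 2 * δ) ^ 2 ≤ 4
* δ` for `(x j - ε j) ^ 2`. The cap thus fits in a box of sides `4 * δ` and `4 * √δ`, all others
being one. -/
theorem volume_oppositeCap_le {n : ℕ} {S : Finset (Fin n)} {ε : Fin n → ℝ}
    (hε : ∀ i, ε i = 0 ∨ ε i = 1) {i j : Fin n} (hi : i ∈ S) (hj : j ∈ S) (hij : i ≠ j) {δ : ℝ}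
    (hδ : 0 < δ) (hδ' : δ < 1 / 2) :
    volume.real (oppositeCap (faceTube n S ε 1) ε i δ) ≤ 16 * δ * √δ := by
  classical
  set a : Fin n → ℝ := fun k =>
    if k = i then 1 - ε i - 2 * δ else if k = j then ε j - 2 * √δ else 0
  set b : Fin n → ℝ := fun k =>
    if k = i then 1 - ε i + 2 * δ else if k = j then ε j + 2 * √δ else 1
  have hsub : oppositeCap (faceTube n S ε 1) ε i δ ⊆ {x | ∀ k, x k ∈ Icc (a k) (b k)} := by
    rintro x ⟨⟨hxQ, hx⟩, hx'⟩
    have hx'' : 1 - 2 * δ ≤ |x i - ε i| := hx'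
    intro k
    by_cases hki : k = i
    · subst hki
      simp only [a, b, if_true]
      have h1 := (hxQ k).1
      have h2 := (hxQ k).2
      rcases hε k with h | h <;> rw [h] at hx'' ⊢
      · rw [sub_zero, abs_of_nonneg h1] at hx''
        constructor <;> linarith
      · rw [abs_of_nonpos (by linarith)] at hx''
        constructor <;> linarith
    by_cases hkj : k = j
    · subst hkj
      simp only [a, b, hki, if_false, if_true]
      have h1 : (x i - ε i) ^ 2 + (x k - ε k) ^ 2 ≤ 1 := by
        rw [one_pow] at hx
        refine le_trans ?_ hx
        rw [← Finset.sum_pair (f := fun i => (x i - ε i) ^ 2) hij]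
        refine Finset.sum_le_sum_of_subset_of_nonneg ?_ fun _ _ _ => sq_nonneg _
        intro l hl
        rw [Finset.mem_insert, Finset.mem_singleton] at hl
        rcases hl with rfl | rfl <;> assumption
      have h2 : (1 - 2 * δ) ^ 2 ≤ (x i - ε i) ^ 2 := by
        rw [← sq_abs (x i - ε i)]
        exact pow_le_pow_left₀ (by linarith) hx'' 2
      have h3 : (x k - ε k) ^ 2 ≤ (2 * √δ) ^ 2 := by
        rw [mul_pow, Real.sq_sqrt hδ.le]; nlinarith
      have h4 := abs_le.1 (abs_le_of_sq_le_sq h3 (by positivity))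
      constructor <;> linarith [h4.1, h4.2]
    · simp only [a, b, hki, hkj, if_false]
      exact hxQ k
  have hbox := volume_preimage_ofLp_pi a b
  have hprod : ∏ k, ENNReal.ofReal (b k - a k) =
      ENNReal.ofReal (4 * δ) * ENNReal.ofReal (4 * √δ) := by
    rw [Finset.prod_eq_mul i j hij]
    · simp only [a, b, if_true, hij.symm, if_false]
      congr 2 <;> ring
    · rintro k - ⟨hki, hkj⟩
      simp [a, b, hki, hkj]
    · simp
    · simp
  rw [hprod, ← ENNReal.ofReal_mul (by positivity)] at hbox
  calc volume.real (oppositeCap (faceTube n S ε 1) ε i δ)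
      ≤ volume.real {x : EuclideanSpace ℝ (Fin n) | ∀ k, x k ∈ Icc (a k) (b k)} :=
        measureReal_mono hsub (by rw [hbox]; exact ENNReal.ofReal_ne_top)
    _ = 4 * δ * (4 * √δ) := by
        rw [measureReal_def, hbox, ENNReal.toReal_ofReal (by positivity)]
    _ = 16 * δ * √δ := by ring

/-- Codimension at least two provides the second coordinate that makes the caps `O(δ ^ (3 / 2))`. In
codimension one the tube of radius one is the whole cube, of perimeter zero, and the bound fails. -/
theorem le_cubePerimeter_faceTube_one {n : ℕ} {S : Finset (Fin n)} {ε : Fin n → ℝ}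
    (hε : ∀ i, ε i = 0 ∨ ε i = 1) (hS : 2 ≤ S.card) :
    ENNReal.ofReal (S.card * volume.real (faceTube n S ε 1)) ≤
      cubePerimeter n (faceTube n S ε 1) := by
  have h := le_cubePerimeter_faceTube_of_tendsto (S := S) hε one_pos fun i hi => ?_
  · simpa using h
  obtain ⟨j, hj, hji⟩ := Finset.exists_mem_ne (by omega : 1 < S.card) i
  have h16 : Filter.Tendsto (fun δ : ℝ => 16 * √δ) (nhdsWithin 0 (Ioi 0)) (nhds 0) := by
    have : Filter.Tendsto (fun δ : ℝ => 16 * √δ) (nhds 0) (nhds (16 * √0)) :=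
      Continuous.tendsto (by fun_prop) 0
    rw [Real.sqrt_zero, mul_zero] at this
    exact this.mono_left nhdsWithin_le_nhds
  have hlt : ∀ᶠ δ : ℝ in nhdsWithin 0 (Ioi 0), δ < 1 / 2 :=
    nhdsWithin_le_nhds (gt_mem_nhds (by norm_num))
  refine tendsto_of_tendsto_of_tendsto_of_le_of_le' tendsto_const_nhds h16 ?_ ?_
  · filter_upwards [self_mem_nhdsWithin] with δ hδ
    have : (0 : ℝ) < δ := hδ
    positivity
  · filter_upwards [hlt, self_mem_nhdsWithin] with δ hδ hpos
    have hpos' : (0 : ℝ) < δ := hpos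
    rw [div_le_iff₀ hpos']
    have := volume_oppositeCap_le hε hi hj hji.symm hpos' hδ
    linarith

/-! ### Perimeter of the unit corner ball -/

theorem tendsto_pow_sub_pow_div (n : ℕ) (r : ℝ) :
    Filter.Tendsto (fun δ : ℝ => ((r + δ) ^ n - r ^ n) / δ) (nhdsWithin 0 (Ioi 0))
      (nhds (n * r ^ (n - 1))) := by
  have h := (hasDerivAt_pow n r).tendsto_slope_zero_right
  refine h.congr fun δ => ?_
  rw [smul_eq_mul, div_eq_inv_mul]

theorem volume_real_faceTube {n : ℕ} {S : Finset (Fin n)} {ε : Fin n → ℝ}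
    (hε : ∀ i, ε i = 0 ∨ ε i = 1) (hS : S.Nonempty) {r : ℝ} (hr : r ∈ Icc (0 : ℝ) 1) :
    volume.real (faceTube n S ε r) = omegaBall S.card / 2 ^ S.card * r ^ S.card := by
  have h1 := omegaBall_pos S.card
  have h2 := hr.1
  rw [measureReal_def, volume_faceTube hε hS hr, ENNReal.toReal_ofReal (by positivity)]

theorem faceTube_mono {n : ℕ} (S : Finset (Fin n)) (ε : Fin n → ℝ) {r s : ℝ} (hr : 0 ≤ r)
    (hrs : r ≤ s) : faceTube n S ε r ⊆ faceTube n S ε s :=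
  fun _ hx => ⟨hx.1, hx.2.trans (pow_le_pow_left₀ hr hrs 2)⟩

theorem faceTube_univ_eq_inter {n : ℕ} (ε : Fin n → ℝ) {r : ℝ} (hr : 0 ≤ r) :
    faceTube n Finset.univ ε r =
      Metric.closedBall (WithLp.toLp 2 ε : EuclideanSpace ℝ (Fin n)) r ∩ unitCube n := by
  ext x
  simp only [faceTube, mem_ofPred_eq, mem_inter_iff, Metric.mem_closedBall,
    EuclideanSpace.dist_eq, Real.dist_eq, sq_abs, Real.sqrt_le_left hr]
  tauto

theorem cubePerimeter_faceTube_univ_one_le {n : ℕ} [NeZero n] {ε : Fin n → ℝ}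
    (hε : ∀ i, ε i = 0 ∨ ε i = 1) :
    cubePerimeter n (faceTube n Finset.univ ε 1) ≤ ENNReal.ofReal (n * (omegaBall n / 2 ^ n)) := by
  have hw := omegaBall_pos n
  have hne : (Finset.univ : Finset (Fin n)).Nonempty := Finset.univ_nonempty
  rw [faceTube_univ_eq_inter ε zero_le_one]
  have hlim : Filter.Tendsto (fun δ : ℝ => omegaBall n / 2 ^ n * ((1 + δ) ^ n - 1) / δ)
      (nhdsWithin 0 (Ioi 0)) (nhds (n * (omegaBall n / 2 ^ n))) := by
    rw [mul_comm (n : ℝ)]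
    simpa only [one_pow, mul_one, mul_div_assoc] using
      (tendsto_pow_sub_pow_div n 1).const_mul (omegaBall n / 2 ^ n)
  refine cubePerimeter_le_of_outerShell Metric.isClosed_closedBall
    ⟨_, Metric.mem_closedBall_self zero_le_one⟩ ?_ hlim
  filter_upwards [self_mem_nhdsWithin] with δ hδ
  have hδ' : (0 : ℝ) < δ := hδ
  have hsub : outerShell n (Metric.closedBall (WithLp.toLp 2 ε) 1) δ ⊆
      faceTube n Finset.univ ε (1 + δ) \ faceTube n Finset.univ ε 1 := by
    rintro x ⟨hxQ, hpos, hlt⟩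
    rw [faceTube_univ_eq_inter ε zero_le_one, faceTube_univ_eq_inter ε (by linarith)]
    refine ⟨⟨?_, hxQ⟩, fun h => ?_⟩
    · obtain ⟨y, hy, hxy⟩ := (Metric.infDist_lt_iff
        ⟨_, Metric.mem_closedBall_self zero_le_one⟩).1 hlt
      rw [Metric.mem_closedBall] at hy ⊢
      linarith [dist_triangle x y (WithLp.toLp 2 ε)]
    · rw [Metric.infDist_zero_of_mem h.1] at hpos
      exact hpos.false
  refine (measureReal_mono hsub (volume_ne_top_of_subset_unitCube
    (sdiff_subset.trans fun x hx => hx.1))).trans ?_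
  rw [measureReal_sdiff (faceTube_mono _ _ zero_le_one (by linarith))
    (isClosed_faceTube _ _ _ _).measurableSet (volume_ne_top_of_subset_unitCube fun x hx => hx.1),
    volume_real_faceTube (r := 1) hε hne (by simp)]
  -- Beyond radius one the ball leaves the cube, so its exact volume is replaced by that of the full
  -- sector.
  have hle : volume.real (faceTube n Finset.univ ε (1 + δ)) ≤
      omegaBall n / 2 ^ n * (1 + δ) ^ n := by
    have h := measure_mono (μ := volume)
      (faceTube_subset_cylinderSector (S := Finset.univ) hε (1 + δ))
    rw [volume_cylinderSector hε hne (by linarith), Finset.card_univ, Fintype.card_fin] at h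
    exact ENNReal.toReal_le_of_le_ofReal (by positivity) h
  rw [Finset.card_univ, Fintype.card_fin, one_pow]
  linarith

/-! ### Ball with a thin column attached along an edge -/

section Column

variable {n : ℕ} (i₀ : Fin n)

theorem volume_prism {s t : Set ℝ} (hs : MeasurableSet s) (ht : MeasurableSet t) :
    volume {x : EuclideanSpace ℝ (Fin n) | x i₀ ∈ s ∧ ∀ i ≠ i₀, x i ∈ t} =
      volume s * volume t ^ (n - 1) := by
  classical
  have h := (PiLp.volume_preserving_ofLp (Fin n)).measure_preimage
    (s := Set.pi univ fun i : Fin n => if i = i₀ then s else t)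
    (MeasurableSet.univ_pi fun i => by split_ifs <;> assumption).nullMeasurableSet
  rw [volume_pi_pi, ← Finset.mul_prod_erase _ _ (Finset.mem_univ i₀), if_pos rfl,
    Finset.prod_congr rfl fun i hi => by rw [if_neg (Finset.ne_of_mem_erase hi)],
    Finset.prod_const, Finset.card_erase_of_mem (Finset.mem_univ _), Finset.card_univ,
    Fintype.card_fin] at h
  rw [← h]
  congr 1
  ext x
  simp only [mem_ofPred_eq, mem_preimage, Set.mem_pi, mem_univ, true_imp_iff]
  constructor
  · rintro ⟨h1, h2⟩ i
    split_ifs with hi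
    · rw [hi]; exact h1
    · exact h2 i hi
  · intro h
    refine ⟨by simpa using h i₀, fun i hi => by simpa [hi] using h i⟩

theorem measurableSet_prism {s t : Set ℝ} (hs : MeasurableSet s) (ht : MeasurableSet t) :
    MeasurableSet {x : EuclideanSpace ℝ (Fin n) | x i₀ ∈ s ∧ ∀ i ≠ i₀, x i ∈ t} := by
  have hm : ∀ i, Measurable fun x : EuclideanSpace ℝ (Fin n) => x i := fun i => by fun_prop
  have : {x : EuclideanSpace ℝ (Fin n) | x i₀ ∈ s ∧ ∀ i ≠ i₀, x i ∈ t} =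
      (fun x : EuclideanSpace ℝ (Fin n) => x i₀) ⁻¹' s ∩
        ⋂ i, ⋂ (_ : i ≠ i₀), (fun x : EuclideanSpace ℝ (Fin n) => x i) ⁻¹' t := by
    ext; simp
  rw [this]
  exact (hs.preimage (hm _)).inter
    (MeasurableSet.iInter fun i => MeasurableSet.iInter fun _ => ht.preimage (hm i))

theorem volume_real_prism_Icc {a b c : ℝ} (hab : a ≤ b) (hc : 0 ≤ c) :
    volume.real {x : EuclideanSpace ℝ (Fin n) | x i₀ ∈ Icc a b ∧ ∀ i ≠ i₀, x i ∈ Icc 0 c} =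
      (b - a) * c ^ (n - 1) := by
  rw [measureReal_def, volume_prism i₀ measurableSet_Icc measurableSet_Icc, Real.volume_Icc,
    Real.volume_Icc, ENNReal.toReal_mul, ENNReal.toReal_pow, ENNReal.toReal_ofReal (by linarith),
    ENNReal.toReal_ofReal (by linarith), sub_zero]

/-- The thin column of width `ρ` around the edge of the cube in direction `i₀` from the origin. -/
def edgeColumn (n : ℕ) (i₀ : Fin n) (ρ : ℝ) : Set (EuclideanSpace ℝ (Fin n)) :=
  {x | x i₀ ∈ Icc (0 : ℝ) 1 ∧ ∀ i ≠ i₀, x i ∈ Icc (0 : ℝ) ρ}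

/-- The part of the ball of radius `r` around the origin in the cube. -/
abbrev cornerBall (n : ℕ) (r : ℝ) : Set (EuclideanSpace ℝ (Fin n)) :=
  faceTube n Finset.univ (fun _ => 0) r

theorem measurableSet_cornerBall (n : ℕ) (r : ℝ) : MeasurableSet (cornerBall n r) :=
  (isClosed_faceTube _ _ _ _).measurableSet

theorem cornerBall_subset_unitCube (n : ℕ) (r : ℝ) : cornerBall n r ⊆ unitCube n :=
  fun _ hx => hx.1

theorem mem_cornerBall_iff {r : ℝ} {x : EuclideanSpace ℝ (Fin n)} :
    x ∈ cornerBall n r ↔ x ∈ unitCube n ∧ x i₀ ^ 2 + ∑ i ∈ Finset.univ.erase i₀, x i ^ 2 ≤ r ^ 2 := by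
  rw [cornerBall, faceTube, Finset.add_sum_erase _ (fun i => x i ^ 2) (Finset.mem_univ i₀)]
  simp

theorem volume_real_cornerBall [NeZero n] {r : ℝ} (hr : r ∈ Icc (0 : ℝ) 1) :
    volume.real (cornerBall n r) = omegaBall n / 2 ^ n * r ^ n := by
  rw [volume_real_faceTube (fun _ => Or.inl rfl) Finset.univ_nonempty hr, Finset.card_univ,
    Fintype.card_fin]

theorem edgeColumn_subset_unitCube {ρ : ℝ} (hρ : ρ ≤ 1) : edgeColumn n i₀ ρ ⊆ unitCube n := by
  rintro x ⟨h1, h2⟩ i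
  by_cases hi : i = i₀
  · rw [hi]; exact h1
  · exact ⟨(h2 i hi).1, (h2 i hi).2.trans hρ⟩

theorem measurableSet_edgeColumn (ρ : ℝ) : MeasurableSet (edgeColumn n i₀ ρ) :=
  measurableSet_prism i₀ measurableSet_Icc measurableSet_Icc

theorem volume_real_edgeColumn {ρ : ℝ} (hρ : 0 ≤ ρ) :
    volume.real (edgeColumn n i₀ ρ) = ρ ^ (n - 1) := by
  rw [edgeColumn, volume_real_prism_Icc i₀ zero_le_one hρ]; ring

theorem sum_erase_sq_le {x : EuclideanSpace ℝ (Fin n)} {c : ℝ}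
    (hx : ∀ i ≠ i₀, x i ∈ Icc (0 : ℝ) c) :
    ∑ i ∈ Finset.univ.erase i₀, x i ^ 2 ≤ n * c ^ 2 := by
  calc ∑ i ∈ Finset.univ.erase i₀, x i ^ 2 ≤ ∑ _i ∈ Finset.univ.erase i₀, c ^ 2 :=
        Finset.sum_le_sum fun i hi => by
          have h := hx i (Finset.ne_of_mem_erase hi)
          exact pow_le_pow_left₀ h.1 h.2 2
    _ ≤ ∑ _i : Fin n, c ^ 2 :=
        Finset.sum_le_sum_of_subset_of_nonneg (Finset.erase_subset _ _) fun _ _ _ => sq_nonneg _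
    _ = n * c ^ 2 := by simp

/-- Growing the ball by `δ` captures at least the length `δ` of every fibre of the column. -/
theorem volume_edgeColumn_inter_cornerBall_add {r ρ δ : ℝ} (hr : 0 ≤ r) (hρ : 0 ≤ ρ) (hρ1 : ρ ≤ 1)
    (hδ : 0 < δ) (hrδ : r + δ ≤ 1) (hρr : n * ρ ^ 2 ≤ r ^ 2) :
    volume.real (edgeColumn n i₀ ρ ∩ cornerBall n r) + δ * ρ ^ (n - 1) ≤
      volume.real (edgeColumn n i₀ ρ ∩ cornerBall n (r + δ)) := by
  set e : EuclideanSpace ℝ (Fin n) := EuclideanSpace.single i₀ δ with he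
  set A := edgeColumn n i₀ ρ ∩ cornerBall n r with hA
  set A' := (fun x => x - e) ⁻¹' A with hA'
  set T := {x : EuclideanSpace ℝ (Fin n) | x i₀ ∈ Ico 0 δ ∧ ∀ i ≠ i₀, x i ∈ Icc 0 ρ} with hT
  have hAm : MeasurableSet A := (measurableSet_edgeColumn i₀ ρ).inter (measurableSet_cornerBall n r)
  have hTm : MeasurableSet T := measurableSet_prism i₀ measurableSet_Ico measurableSet_Icc
  have hvA : volume.real A' = volume.real A := by
    rw [measureReal_def, measureReal_def,
      (measurePreserving_sub_right volume e).measure_preimage hAm.nullMeasurableSet]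
  have hvT : volume.real T = δ * ρ ^ (n - 1) := by
    rw [measureReal_def, volume_prism i₀ measurableSet_Ico measurableSet_Icc, Real.volume_Icc,
      Real.volume_Ico, ENNReal.toReal_mul, ENNReal.toReal_pow, ENNReal.toReal_ofReal (by linarith),
      ENNReal.toReal_ofReal (by linarith), sub_zero, sub_zero]
  have he0 : e i₀ = δ := by simp [he]
  have hei : ∀ i ≠ i₀, e i = 0 := fun i hi => by simp [he, hi]
  have hdisj : Disjoint A' T := by
    rw [disjoint_left]
    rintro x hx hx'
    have h1 : 0 ≤ (x - e) i₀ := hx.1.1.1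
    rw [PiLp.sub_apply, he0] at h1
    linarith [hx'.1.2]
  have hr1 : r ≤ 1 := by linarith
  -- Lift the column part of the ball by `δ` along the edge and insert the slab `T` of height `δ`
  -- underneath; both fit into the larger ball.
  have hsub : A' ∪ T ⊆ edgeColumn n i₀ ρ ∩ cornerBall n (r + δ) := by
    rintro x (hx | hx)
    · obtain ⟨⟨h1, h2⟩, h3⟩ := hx
      have hsum := ((mem_cornerBall_iff i₀).1 h3).2
      rw [PiLp.sub_apply, he0] at h1
      have h2' : ∀ i ≠ i₀, x i ∈ Icc (0 : ℝ) ρ := fun i hi => by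
        have := h2 i hi
        rwa [PiLp.sub_apply, hei i hi, sub_zero] at this
      have hsum' : (x i₀ - δ) ^ 2 + ∑ i ∈ Finset.univ.erase i₀, x i ^ 2 ≤ r ^ 2 := by
        rw [PiLp.sub_apply, he0, Finset.sum_congr rfl fun i hi => by
          rw [PiLp.sub_apply, hei i (Finset.ne_of_mem_erase hi), sub_zero]] at hsum
        exact hsum
      have hs0 : 0 ≤ ∑ i ∈ Finset.univ.erase i₀, x i ^ 2 :=
        Finset.sum_nonneg fun _ _ => sq_nonneg _
      have hle : x i₀ - δ ≤ r := (sq_le_sq₀ h1.1 hr).1 (by linarith)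
      have hcol : x ∈ edgeColumn n i₀ ρ := ⟨⟨by linarith [h1.1], by linarith⟩, h2'⟩
      refine ⟨hcol, (mem_cornerBall_iff i₀).2 ⟨edgeColumn_subset_unitCube i₀ hρ1 hcol, ?_⟩⟩
      nlinarith
    · have hcol : x ∈ edgeColumn n i₀ ρ :=
        ⟨⟨hx.1.1, by linarith [hx.1.2]⟩, hx.2⟩
      refine ⟨hcol, (mem_cornerBall_iff i₀).2 ⟨edgeColumn_subset_unitCube i₀ hρ1 hcol, ?_⟩⟩
      have h1 := sum_erase_sq_le i₀ hx.2
      have h2 : x i₀ ^ 2 ≤ δ ^ 2 := pow_le_pow_left₀ hx.1.1 hx.1.2.le 2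
      nlinarith [mul_nonneg hr hδ.le]
  rw [← hvT, ← hvA, ← measureReal_union hdisj hTm (h₁ := ?_) (h₂ := ?_)]
  · exact measureReal_mono hsub
      (volume_ne_top_of_subset_unitCube (inter_subset_right.trans (cornerBall_subset_unitCube _ _)))
  · exact volume_ne_top_of_subset_unitCube (subset_union_left.trans
      (hsub.trans (inter_subset_right.trans (cornerBall_subset_unitCube _ _))))
  · exact volume_ne_top_of_subset_unitCube (subset_union_right.trans
      (hsub.trans (inter_subset_right.trans (cornerBall_subset_unitCube _ _))))

/-- After division by `δ` this is the saving: the spherical piece inside the column has area at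
least that of its projection, `ρ ^ (n - 1)`. -/
theorem volume_cornerBall_sdiff_le [NeZero n] {r ρ δ : ℝ} (hr : 0 ≤ r) (hρ : 0 ≤ ρ) (hρ1 : ρ ≤ 1)
    (hδ : 0 < δ) (hrδ : r + δ ≤ 1) (hρr : n * ρ ^ 2 ≤ r ^ 2) :
    volume.real (cornerBall n (r + δ) \ (cornerBall n r ∪ edgeColumn n i₀ ρ)) ≤
      omegaBall n / 2 ^ n * ((r + δ) ^ n - r ^ n) - δ * ρ ^ (n - 1) := by
  have hfin : ∀ s, volume (cornerBall n s) ≠ ∞ := fun s =>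
    volume_ne_top_of_subset_unitCube (cornerBall_subset_unitCube n s)
  have hmono : cornerBall n r ⊆ cornerBall n (r + δ) := faceTube_mono _ _ hr (by linarith)
  have hkey := volume_edgeColumn_inter_cornerBall_add i₀ hr hρ hρ1 hδ hrδ hρr
  have hset : cornerBall n (r + δ) \ (cornerBall n r ∪ edgeColumn n i₀ ρ) =
      cornerBall n (r + δ) \ (cornerBall n r ∪ (edgeColumn n i₀ ρ ∩ cornerBall n (r + δ))) := by
    ext x
    simp only [mem_sdiff, mem_union, mem_inter_iff]
    tauto
  have hint : cornerBall n r ∩ (edgeColumn n i₀ ρ ∩ cornerBall n (r + δ)) =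
      edgeColumn n i₀ ρ ∩ cornerBall n r := by
    ext x
    simp only [mem_inter_iff]
    exact ⟨fun h => ⟨h.2.1, h.1⟩, fun h => ⟨h.2, h.1, hmono h.2⟩⟩
  have hm := (measurableSet_edgeColumn i₀ ρ).inter (measurableSet_cornerBall n (r + δ))
  have hunion := measureReal_union_add_inter (μ := volume) (s := cornerBall n r) hm
    (hfin r) (measure_ne_top_of_subset inter_subset_right (hfin (r + δ)))
  rw [hint] at hunion
  rw [hset, measureReal_sdiff (union_subset hmono inter_subset_right)
    ((measurableSet_cornerBall n r).union hm) (hfin _),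
    volume_real_cornerBall ⟨by linarith, hrδ⟩]
  rw [volume_real_cornerBall ⟨hr, by linarith⟩] at hunion
  linarith

/-- The three terms are the sphere, the spherical piece saved inside the column, and the lateral
boundary of the column. By `hcond` the lateral boundary leaves the ball only above height `1 - h`.
-/
theorem cubePerimeter_cornerBall_union_edgeColumn_le [NeZero n] {r ρ h : ℝ} (hr : 0 < r)
    (hr1 : r < 1) (hρ : 0 < ρ) (hρ1 : ρ ≤ 1) (hh0 : 0 ≤ h) (hh1 : h ≤ 1)
    (hcond : (1 - h) ^ 2 + n * (2 * ρ) ^ 2 ≤ r ^ 2) :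
    cubePerimeter n (cornerBall n r ∪ edgeColumn n i₀ ρ) ≤
      ENNReal.ofReal (omegaBall n / 2 ^ n * (n * r ^ (n - 1)) - ρ ^ (n - 1) +
        h * ((n - 1 : ℕ) * ρ ^ (n - 1 - 1))) := by
  set D : Set (EuclideanSpace ℝ (Fin n)) := {x | ∀ i ≠ i₀, x i ≤ ρ} with hD
  set K := Metric.closedBall (0 : EuclideanSpace ℝ (Fin n)) r ∪ D with hK
  have hDc : IsClosed D := by
    have : D = ⋂ i, ⋂ (_ : i ≠ i₀), {x | x i ≤ ρ} := by ext; simp [hD]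
    rw [this]
    exact isClosed_iInter fun i => isClosed_iInter fun _ => isClosed_le
      (show Continuous fun x : EuclideanSpace ℝ (Fin n) => x i by fun_prop) continuous_const
  have hKc : IsClosed K := Metric.isClosed_closedBall.union hDc
  have hKne : K.Nonempty := ⟨0, Or.inl (Metric.mem_closedBall_self hr.le)⟩
  have hball : ∀ s, 0 ≤ s → cornerBall n s = Metric.closedBall 0 s ∩ unitCube n := fun s hs => by
    rw [cornerBall, faceTube_univ_eq_inter _ hs]; rfl
  have hcol : edgeColumn n i₀ ρ = D ∩ unitCube n := by
    ext x
    constructor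
    · exact fun hx => ⟨fun i hi => (hx.2 i hi).2, edgeColumn_subset_unitCube i₀ hρ1 hx⟩
    · exact fun hx => ⟨hx.2 i₀, fun i hi => ⟨(hx.2 i).1, hx.1 i hi⟩⟩
  have hE : cornerBall n r ∪ edgeColumn n i₀ ρ = K ∩ unitCube n := by
    rw [hball r hr.le, hcol, hK, union_inter_distrib_right]
  rw [hE]
  have hlim : Filter.Tendsto (fun δ : ℝ =>
      (omegaBall n / 2 ^ n * ((r + δ) ^ n - r ^ n) - δ * ρ ^ (n - 1) +
        h * ((ρ + δ) ^ (n - 1) - ρ ^ (n - 1))) / δ) (nhdsWithin 0 (Ioi 0))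
      (nhds (omegaBall n / 2 ^ n * (n * r ^ (n - 1)) - ρ ^ (n - 1) +
        h * ((n - 1 : ℕ) * ρ ^ (n - 1 - 1)))) := by
    refine ((((tendsto_pow_sub_pow_div n r).const_mul (omegaBall n / 2 ^ n)).sub_const
      (ρ ^ (n - 1))).add ((tendsto_pow_sub_pow_div (n - 1) ρ).const_mul h)).congr' ?_
    filter_upwards [self_mem_nhdsWithin] with δ hδ
    have hδ' : (δ : ℝ) ≠ 0 := (show (0 : ℝ) < δ from hδ).ne'
    field_simp
  refine cubePerimeter_le_of_outerShell hKc hKne ?_ hlim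
  have hlt1 : ∀ᶠ δ : ℝ in nhdsWithin 0 (Ioi 0), δ < 1 - r :=
    nhdsWithin_le_nhds (gt_mem_nhds (by linarith))
  have hlt2 : ∀ᶠ δ : ℝ in nhdsWithin 0 (Ioi 0), δ < ρ := nhdsWithin_le_nhds (gt_mem_nhds hρ)
  filter_upwards [hlt1, hlt2, self_mem_nhdsWithin] with δ hδ1 hδ2 hδ
  have hδ0 : (0 : ℝ) < δ := hδ
  set L := {x : EuclideanSpace ℝ (Fin n) | x i₀ ∈ Icc (1 - h) 1 ∧ ∀ i ≠ i₀, x i ∈ Icc 0 (ρ + δ)}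
  set L' := {x : EuclideanSpace ℝ (Fin n) | x i₀ ∈ Icc (1 - h) 1 ∧ ∀ i ≠ i₀, x i ∈ Icc 0 ρ}
  have hLL : L' ⊆ L := fun x hx => ⟨hx.1, fun i hi =>
    ⟨(hx.2 i hi).1, by linarith [(hx.2 i hi).2]⟩⟩
  have hLfin : volume L ≠ ∞ := by
    rw [volume_prism i₀ measurableSet_Icc measurableSet_Icc, Real.volume_Icc, Real.volume_Icc]
    finiteness
  have hsub : outerShell n K δ ⊆
      (cornerBall n (r + δ) \ (cornerBall n r ∪ edgeColumn n i₀ ρ)) ∪ (L \ L') := by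
    rintro x ⟨hxQ, hpos, hlt⟩
    have hxK : x ∉ K := fun hx => by
      rw [Metric.infDist_zero_of_mem hx] at hpos
      exact hpos.false
    have hxB : x ∉ cornerBall n r := fun hx => hxK (Or.inl (by rw [hball r hr.le] at hx; exact hx.1))
    have hxC : x ∉ edgeColumn n i₀ ρ := fun hx => hxK (Or.inr (by rw [hcol] at hx; exact hx.1))
    obtain ⟨y, hy, hxy⟩ := (Metric.infDist_lt_iff hKne).1 hlt
    rcases hy with hy | hy
    · left
      refine ⟨?_, fun hx => hx.elim hxB hxC⟩
      rw [hball _ (by linarith)]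
      refine ⟨?_, hxQ⟩
      rw [Metric.mem_closedBall] at hy ⊢
      linarith [dist_triangle x y 0]
    · right
      have hxi : ∀ i ≠ i₀, x i ∈ Icc (0 : ℝ) (ρ + δ) := fun i hi => by
        refine ⟨(hxQ i).1, ?_⟩
        have h1 : ‖(x - y) i‖ ≤ ‖x - y‖ := PiLp.norm_apply_le (x - y) i
        rw [← dist_eq_norm, PiLp.sub_apply, Real.norm_eq_abs] at h1
        linarith [le_abs_self (x i - y i), hy i hi]
      refine ⟨⟨⟨?_, (hxQ i₀).2⟩, hxi⟩, fun hx => hxC ⟨hxQ i₀, hx.2⟩⟩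
      have hsum := sum_erase_sq_le i₀ hxi
      have hgt : r ^ 2 < x i₀ ^ 2 + ∑ i ∈ Finset.univ.erase i₀, x i ^ 2 := by
        by_contra hle
        exact hxB ((mem_cornerBall_iff i₀).2 ⟨hxQ, not_lt.1 hle⟩)
      -- Since `δ < ρ`, the thickened column has width at most `2 * ρ`, whence the factor 2 in
      -- `hcond`.
      have h2 : (n : ℝ) * (ρ + δ) ^ 2 ≤ n * (2 * ρ) ^ 2 := by gcongr; linarith
      exact (sq_le_sq₀ (by linarith) (hxQ i₀).1).1 (by linarith)
  have hfin1 : volume (cornerBall n (r + δ) \ (cornerBall n r ∪ edgeColumn n i₀ ρ)) ≠ ∞ :=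
    volume_ne_top_of_subset_unitCube (sdiff_subset.trans (cornerBall_subset_unitCube _ _))
  have hfin2 : volume (L \ L') ≠ ∞ := measure_ne_top_of_subset sdiff_subset hLfin
  refine (measureReal_mono hsub (measure_union_ne_top hfin1 hfin2)).trans ?_
  refine (measureReal_union_le _ _).trans (add_le_add ?_ ?_)
  · refine volume_cornerBall_sdiff_le i₀ hr.le hρ.le hρ1 hδ0 (by linarith) ?_
    have : (0 : ℝ) ≤ n * ρ ^ 2 := by positivity
    nlinarith [sq_nonneg (1 - h)]
  · rw [measureReal_sdiff hLL (measurableSet_prism i₀ measurableSet_Icc measurableSet_Icc) hLfin,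
      volume_real_prism_Icc i₀ (by linarith) (by linarith),
      volume_real_prism_Icc i₀ (by linarith) hρ.le]
    apply le_of_eq; ring

end Column

/-! ### The competitor of smaller perimeter -/

section Competitor

variable {n : ℕ} (i₀ : Fin n)

/-- The column protrudes from the unit ball in a nonempty open set. Strictness later gives a radius
below one. -/
theorem lt_volume_real_cornerBall_one_union [NeZero n] (hn : 2 ≤ n) {ρ : ℝ} (hρ : 0 < ρ)
    (hρ1 : ρ ≤ 1) :
    omegaBall n / 2 ^ n < volume.real (cornerBall n 1 ∪ edgeColumn n i₀ ρ) := by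
  set O := {x : EuclideanSpace ℝ (Fin n) |
    (x i₀ ∈ Ioo (0 : ℝ) 1 ∧ ∀ i ≠ i₀, x i ∈ Ioo (0 : ℝ) ρ) ∧ 1 < ∑ i, x i ^ 2} with hO
  have hopen : IsOpen O := by
    have hc : ∀ i, Continuous fun x : EuclideanSpace ℝ (Fin n) => x i := fun i => by fun_prop
    have : O = ((fun x : EuclideanSpace ℝ (Fin n) => x i₀) ⁻¹' Ioo 0 1 ∩
        ⋂ i, ⋂ (_ : i ≠ i₀), (fun x : EuclideanSpace ℝ (Fin n) => x i) ⁻¹' Ioo 0 ρ) ∩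
        {x | 1 < ∑ i, x i ^ 2} := by ext; simp [hO]
    rw [this]
    exact ((isOpen_Ioo.preimage (hc _)).inter (isOpen_iInter_of_finite fun i =>
      isOpen_iInter_of_finite fun _ => isOpen_Ioo.preimage (hc i))).inter
      (isOpen_lt continuous_const (show Continuous fun x : EuclideanSpace ℝ (Fin n) =>
        ∑ i, x i ^ 2 by fun_prop))
  have hne : O.Nonempty := by
    -- The first coordinate loses at most `ρ ^ 2 / 8` in the sum of squares, while any other one
    -- contributes `ρ ^ 2 / 4`.
    refine ⟨WithLp.toLp 2 fun i => if i = i₀ then 1 - ρ ^ 2 / 16 else ρ / 2, ⟨?_, ?_⟩, ?_⟩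
    · simp only [if_true]
      constructor <;> nlinarith
    · intro i hi
      simp only [hi, if_false]
      constructor <;> linarith
    · have hsum : ∑ i ∈ Finset.univ.erase i₀, (if i = i₀ then 1 - ρ ^ 2 / 16 else ρ / 2) ^ 2 =
          (n - 1 : ℕ) * (ρ / 2) ^ 2 := by
        rw [Finset.sum_congr rfl fun i hi => by rw [if_neg (Finset.ne_of_mem_erase hi)],
          Finset.sum_const, Finset.card_erase_of_mem (Finset.mem_univ _), Finset.card_univ,
          Fintype.card_fin, nsmul_eq_mul]
      rw [← Finset.add_sum_erase _ _ (Finset.mem_univ i₀)]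
      simp only [if_true]
      rw [hsum]
      have h1 : (1 : ℝ) ≤ (n - 1 : ℕ) := by exact_mod_cast (by omega : 1 ≤ n - 1)
      have h2 : (0 : ℝ) < ρ ^ 2 := by positivity
      have h3 : (ρ / 2) ^ 2 ≤ (n - 1 : ℕ) * (ρ / 2) ^ 2 := le_mul_of_one_le_left (by positivity) h1
      nlinarith
  have hpos : 0 < volume O := hopen.measure_pos volume hne
  have hsub : O ⊆ edgeColumn n i₀ ρ := fun x hx =>
    ⟨Ioo_subset_Icc_self hx.1.1, fun i hi => Ioo_subset_Icc_self (hx.1.2 i hi)⟩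
  have hOfin : volume O ≠ ∞ :=
    volume_ne_top_of_subset_unitCube (hsub.trans (edgeColumn_subset_unitCube i₀ hρ1))
  have hdisj : Disjoint (cornerBall n 1) O := by
    rw [disjoint_left]
    intro x hx hx'
    have h1 := hx.2
    simp only [sub_zero, one_pow] at h1
    exact absurd hx'.2 (not_lt.2 h1)
  have hfin : volume (cornerBall n 1) ≠ ∞ :=
    volume_ne_top_of_subset_unitCube (cornerBall_subset_unitCube n 1)
  have hadd := measureReal_union (μ := volume) hdisj hopen.measurableSet hfin hOfin
  rw [volume_real_cornerBall (by simp), one_pow, mul_one] at hadd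
  have hle := measureReal_mono (μ := volume) (union_subset_union_right (cornerBall n 1) hsub)
    (measure_union_ne_top hfin
      (volume_ne_top_of_subset_unitCube (edgeColumn_subset_unitCube i₀ hρ1)))
  have hOpos : 0 < volume.real O := ENNReal.toReal_pos hpos.ne' hOfin
  linarith

/-- Intermediate value theorem in the radius: the volume is at most `w` at radius 0, exceeds `w` at
radius 1, and increases by no more than the volume of the ball does, hence continuously. -/
theorem exists_radius_volume_union_eq [NeZero n] (hn : 2 ≤ n) {ρ : ℝ} (hρ : 0 < ρ) (hρ1 : ρ ≤ 1)
    (hρw : ρ ^ (n - 1) ≤ omegaBall n / 2 ^ n) :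
    ∃ r ∈ Ico (0 : ℝ) 1,
      volume.real (cornerBall n r ∪ edgeColumn n i₀ ρ) = omegaBall n / 2 ^ n := by
  set w := omegaBall n / 2 ^ n with hw
  have hw0 : 0 < w := div_pos (omegaBall_pos n) (by positivity)
  set G : ℝ → ℝ := fun r => volume.real (cornerBall n r ∪ edgeColumn n i₀ ρ) with hG
  have hcolQ := edgeColumn_subset_unitCube i₀ hρ1
  have hfin : ∀ r, volume (cornerBall n r ∪ edgeColumn n i₀ ρ) ≠ ∞ := fun r =>
    volume_ne_top_of_subset_unitCube (union_subset (cornerBall_subset_unitCube n r) hcolQ)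
  have hGle : ∀ s ∈ Icc (0 : ℝ) 1, ∀ t ∈ Icc (0 : ℝ) 1, s ≤ t →
      |G t - G s| ≤ |w * t ^ n - w * s ^ n| := by
    intro s hs t ht hst
    have hsub := faceTube_mono (n := n) Finset.univ (fun _ => 0) hs.1 hst
    have h1 : G s ≤ G t := measureReal_mono (union_subset_union_left _ hsub) (hfin t)
    have h2 : G t ≤ G s + volume.real (cornerBall n t \ cornerBall n s) := by
      refine (measureReal_mono ?_ (measure_union_ne_top (hfin s) ?_)).trans
        (measureReal_union_le _ _)
      · intro x hx
        simp only [mem_union, mem_sdiff] at hx ⊢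
        tauto
      · exact volume_ne_top_of_subset_unitCube (sdiff_subset.trans (cornerBall_subset_unitCube n t))
    rw [measureReal_sdiff hsub (measurableSet_cornerBall n s)
      (volume_ne_top_of_subset_unitCube (cornerBall_subset_unitCube n t)),
      volume_real_cornerBall hs, volume_real_cornerBall ht] at h2
    rw [abs_of_nonneg (by linarith)]
    refine le_trans ?_ (le_abs_self _)
    linarith
  have hGabs : ∀ s ∈ Icc (0 : ℝ) 1, ∀ t ∈ Icc (0 : ℝ) 1,
      |G t - G s| ≤ |w * t ^ n - w * s ^ n| := by
    intro s hs t ht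
    rcases le_total s t with h | h
    · exact hGle s hs t ht h
    · rw [abs_sub_comm, abs_sub_comm (w * t ^ n)]
      exact hGle t ht s hs h
  have hcont : ContinuousOn G (Icc 0 1) := by
    rw [Metric.continuousOn_iff]
    intro b hb ε hε
    have hH : Continuous fun t : ℝ => w * t ^ n := by fun_prop
    obtain ⟨δ, hδ, hδ'⟩ := Metric.continuous_iff.1 hH b ε hε
    refine ⟨δ, hδ, fun a ha hab => ?_⟩
    have := hδ' a hab
    rw [Real.dist_eq] at this ⊢
    exact (hGabs b hb a ha).trans_lt this
  have hG0 : G 0 ≤ w := by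
    refine (measureReal_union_le _ _).trans ?_
    rw [volume_real_cornerBall (by simp), volume_real_edgeColumn i₀ hρ.le,
      zero_pow (by omega), mul_zero, zero_add]
    exact hρw
  have hG1 : w < G 1 := lt_volume_real_cornerBall_one_union i₀ hn hρ hρ1
  obtain ⟨r, hr, hrw⟩ := intermediate_value_Icc zero_le_one hcont ⟨hG0, hG1.le⟩
  refine ⟨r, ⟨hr.1, lt_of_le_of_ne hr.2 ?_⟩, hrw⟩
  rintro rfl
  exact hG1.ne' hrw

/-- The corner ball of radius one is not optimal: attaching a thin column along an edge, where the
ball touches the opposite wall, and shrinking the radius saves perimeter. -/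
theorem exists_cubePerimeter_lt [NeZero n] (hn : 10 ≤ n) :
    ∃ E : Set (EuclideanSpace ℝ (Fin n)), MeasurableSet E ∧ E ⊆ unitCube n ∧
      volume E = ENNReal.ofReal (omegaBall n / 2 ^ n) ∧
      cubePerimeter n E < ENNReal.ofReal (n * (omegaBall n / 2 ^ n)) := by
  set i₀ : Fin n := 0
  set w := omegaBall n / 2 ^ n with hw
  have hw0 : 0 < w := div_pos (omegaBall_pos n) (by positivity)
  have hn' : (10 : ℝ) ≤ n := by exact_mod_cast hn
  have hn0 : (0 : ℝ) < n := by linarith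
  -- Chosen so that `ρ ^ 2 * (4 * n + 1 / w)`, the height required by tangency and by the loss of
  -- radius, equals `ρ / (2 * n)`.
  set ρ : ℝ := 1 / (2 * n * (4 * n + 1 / w)) with hρdef
  have hρ : 0 < ρ := by positivity
  have hρeq : ρ * (4 * n + 1 / w) = 1 / (2 * n) := by rw [hρdef]; field_simp
  have hn2 : 1 / (2 * n : ℝ) ≤ 1 / 20 := one_div_le_one_div_of_le (by norm_num) (by linarith)
  have hρ1 : ρ ≤ 1 := by
    have h1 : 0 < ρ * (1 / w) := by positivity
    nlinarith
  have hρw' : ρ ≤ w := by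
    have h1 : ρ * (1 / w) ≤ 1 := by
      have : 0 < ρ * (4 * n) := by positivity
      nlinarith
    rwa [mul_one_div, div_le_one hw0] at h1
  have hρpow : ρ ^ (n - 1) ≤ ρ ^ 2 := pow_le_pow_of_le_one hρ.le hρ1 (by omega)
  have hρw : ρ ^ (n - 1) ≤ w := by nlinarith
  obtain ⟨r, hr, hvol⟩ := exists_radius_volume_union_eq i₀ (by omega) hρ hρ1 hρw
  rw [← hw] at hvol
  have hcolQ := edgeColumn_subset_unitCube i₀ hρ1
  have hEQ : cornerBall n r ∪ edgeColumn n i₀ ρ ⊆ unitCube n :=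
    union_subset (cornerBall_subset_unitCube n r) hcolQ
  have hwle : w ≤ w * r ^ n + ρ ^ (n - 1) := by
    have h := measureReal_union_le (μ := volume) (cornerBall n r) (edgeColumn n i₀ ρ)
    rwa [hvol, volume_real_cornerBall ⟨hr.1, hr.2.le⟩, volume_real_edgeColumn i₀ hρ.le] at h
  have hrn : r ^ n ≤ r ^ 2 := pow_le_pow_of_le_one hr.1 hr.2.le (by omega)
  -- The loss of radius is `O(ρ ^ 2)`, because the column adds volume at most `ρ ^ (n - 1) ≤ ρ ^ 2`.
  have hr2 : 1 - ρ ^ 2 * (1 / w) ≤ r ^ 2 := by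
    have h1 : w - ρ ^ 2 ≤ w * r ^ 2 := by nlinarith
    have h2 : 1 - ρ ^ 2 * (1 / w) = (w - ρ ^ 2) / w := by field_simp
    rw [h2, div_le_iff₀ hw0]
    linarith
  set h : ℝ := ρ / (2 * n) with hh
  have hh0 : 0 ≤ h := by positivity
  have hheq : h = ρ ^ 2 * (4 * n + 1 / w) := by
    rw [pow_two, mul_assoc, hρeq, hh]; ring
  have hhle : h ≤ 1 / 20 := by
    rw [hh, div_eq_mul_one_div]
    exact (mul_le_of_le_one_left (by positivity) hρ1).trans hn2
  have hcond : (1 - h) ^ 2 + n * (2 * ρ) ^ 2 ≤ r ^ 2 := by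
    have h1 : (1 - h) ^ 2 ≤ 1 - h := by nlinarith
    have h2 : h = n * (2 * ρ) ^ 2 + ρ ^ 2 * (1 / w) := by rw [hheq]; ring
    linarith
  have hrpos : 0 < r := by
    refine lt_of_le_of_ne hr.1 fun h0 => ?_
    rw [← h0] at hcond
    have : (0 : ℝ) ≤ n * (2 * ρ) ^ 2 := by positivity
    nlinarith
  refine ⟨_, (measurableSet_cornerBall n r).union (measurableSet_edgeColumn i₀ ρ), hEQ, ?_, ?_⟩
  · rw [← hvol, ofReal_measureReal (volume_ne_top_of_subset_unitCube hEQ)]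
  · refine (cubePerimeter_cornerBall_union_edgeColumn_le i₀ hrpos hr.2 hρ hρ1 hh0 (by linarith)
      hcond).trans_lt ((ENNReal.ofReal_lt_ofReal_iff (by positivity)).2 ?_)
    have h1 : r ^ (n - 1) ≤ 1 := pow_le_one₀ hr.1 hr.2.le
    have h2 : w * (n * r ^ (n - 1)) ≤ n * w := by
      have := mul_le_mul_of_nonneg_left h1 (show 0 ≤ w * n by positivity)
      linarith
    have h3 : ρ ^ (n - 1) = ρ * ρ ^ (n - 1 - 1) := by
      rw [← pow_succ', Nat.sub_add_cancel (by omega : 1 ≤ n - 1)]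
    -- With `h = ρ / (2 * n)` the lateral boundary costs at most half of what is saved on the
    -- sphere.
    have h4 : h * ((n - 1 : ℕ) * ρ ^ (n - 1 - 1)) ≤ ρ ^ (n - 1) / 2 := by
      have hc : ((n - 1 : ℕ) : ℝ) ≤ n := by exact_mod_cast Nat.sub_le n 1
      calc h * ((n - 1 : ℕ) * ρ ^ (n - 1 - 1)) ≤ h * (n * ρ ^ (n - 1 - 1)) := by gcongr
        _ = ρ * ρ ^ (n - 1 - 1) / 2 := by rw [hh]; field_simp
        _ = ρ ^ (n - 1) / 2 := by rw [h3]
    have h5 : 0 < ρ ^ (n - 1) := by positivity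
    linarith

end Competitor

/-! ### Comparison with all tubes, and conclusion -/

theorem cubePerimeter_faceTube_univ_one {n : ℕ} (hn : 2 ≤ n) {ε : Fin n → ℝ}
    (hε : ∀ i, ε i = 0 ∨ ε i = 1) :
    cubePerimeter n (faceTube n Finset.univ ε 1) =
      ENNReal.ofReal (n * (omegaBall n / 2 ^ n)) := by
  have : NeZero n := ⟨by omega⟩
  refine le_antisymm (cubePerimeter_faceTube_univ_one_le hε) ?_
  have h := le_cubePerimeter_faceTube_one (S := Finset.univ) hε (by simpa using hn)
  rw [volume_real_faceTube hε Finset.univ_nonempty (by simp)] at h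
  simpa using h

/-- A tube around a face, or the complement of such a tube, of the volume of the corner ball of
radius one is that ball around a vertex or has larger perimeter. -/
theorem lt_cubePerimeter_of_volume_eq {n : ℕ} (hn : 10 ≤ n) {S : Finset (Fin n)} {ε : Fin n → ℝ}
    (hε : ∀ i, ε i = 0 ∨ ε i = 1) (hS : S.Nonempty) {r : ℝ} (hr : r ∈ Ioc (0 : ℝ) 1)
    {E : Set (EuclideanSpace ℝ (Fin n))}
    (hE : E = faceTube n S ε r ∨ E = unitCube n \ faceTube n S ε r)
    (hvol : volume E = ENNReal.ofReal (omegaBall n / 2 ^ n)) :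
    (S.card = n ∧ r = 1 ∧ E = faceTube n S ε r) ∨
      ENNReal.ofReal (n * (omegaBall n / 2 ^ n)) < cubePerimeter n E := by
  set w := omegaBall n / 2 ^ n with hw
  have hw0 : 0 < w := div_pos (omegaBall_pos n) (by positivity)
  have hn0 : (0 : ℝ) < n := by exact_mod_cast (by omega : 0 < n)
  have hwn : w * n < 1 := (lt_div_iff₀ hn0).1 (omegaBall_div_lt_inv hn)
  have hr0 : 0 < r := hr.1
  have hF := volume_real_faceTube hε hS ⟨hr.1.le, hr.2⟩
  have hcard : 1 ≤ S.card := hS.card_pos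
  have hcardn : S.card ≤ n := by simpa using Finset.card_le_univ S
  have hvol' : volume.real E = w := by rw [measureReal_def, hvol, ENNReal.toReal_ofReal hw0.le]
  have hFQ : faceTube n S ε r ⊆ unitCube n := fun x hx => hx.1
  rcases hE with rfl | rfl
  · rw [hvol'] at hF
    rcases hcardn.eq_or_lt with hc | hc
    · left
      refine ⟨hc, ?_, rfl⟩
      rw [hc, ← hw] at hF
      have h1 : r ^ n = 1 := by
        have : w * r ^ n = w * 1 := by linarith
        exact mul_left_cancel₀ hw0.ne' this
      exact (pow_eq_one_iff_of_nonneg hr0.le (by omega)).1 h1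
    · right
      have hlt := omegaBall_div_lt hn hcard hc
      rw [← hw, hF] at hlt
      have hwS : 0 < omegaBall S.card / 2 ^ S.card := div_pos (omegaBall_pos _) (by positivity)
      -- Equality of volumes turns the comparison of ball constants into `r < S.card / n`, which is
      -- exactly what makes `S.card * w / r` exceed `n * w`.
      have hrlt : r < S.card / n :=
        lt_of_pow_lt_pow_left₀ S.card (by positivity) (lt_of_mul_lt_mul_left hlt hwS.le)
      have hcr : (S.card : ℝ) < n := by exact_mod_cast hc
      have hr1 : r < 1 := hrlt.trans ((div_lt_one hn0).2 hcr)
      refine lt_of_lt_of_le ?_ (le_cubePerimeter_faceTube_of_lt_one hε hr0 hr1)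
      have hS0 : (0 : ℝ) < S.card := by exact_mod_cast hcard
      rw [hvol', ENNReal.ofReal_lt_ofReal_iff (by positivity), lt_div_iff₀ hr0]
      rw [lt_div_iff₀ hn0] at hrlt
      nlinarith
  · right
    rw [cubePerimeter_sdiff (isClosed_faceTube _ _ _ _).measurableSet hFQ]
    have hV : volume.real (faceTube n S ε r) = 1 - w := by
      rw [measureReal_sdiff hFQ (isClosed_faceTube _ _ _ _).measurableSet
        (volume_ne_top_of_subset_unitCube subset_rfl), measureReal_def (s := unitCube n),
        volume_unitCube, ENNReal.toReal_one] at hvol'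
      linarith
    have hw10 : w < 1 / 10 := by
      have : (10 : ℝ) ≤ n := by exact_mod_cast hn
      nlinarith
    rw [hV] at hF
    -- The tube has volume `1 - w > 9 / 10`, whereas in codimension at least two it has volume at
    -- most π / 4. What remains is a slab, with volume equal to its radius and perimeter at least 1.
    have hc1 : S.card = 1 := by
      by_contra hne
      have h1 := omegaBall_div_le (show 2 ≤ S.card by omega)
      have h2 : r ^ S.card ≤ 1 := pow_le_one₀ hr0.le hr.2
      have h3 : 0 < omegaBall S.card / 2 ^ S.card := div_pos (omegaBall_pos _) (by positivity)
      have h4 := mul_le_of_le_one_right h3.le h2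
      have := Real.pi_lt_d4
      norm_num at this
      linarith
    rw [hc1, omegaBall_one] at hF
    norm_num at hF
    have hr1 : r < 1 := by linarith
    refine lt_of_lt_of_le ?_ (le_cubePerimeter_faceTube_of_lt_one hε hr0 hr1)
    rw [hV, hF, hc1, Nat.cast_one, one_mul, div_self hr0.ne',
      ENNReal.ofReal_lt_ofReal_iff one_pos]
    linarith

theorem theorem1p4 (n : ℕ) (hn : 10 ≤ n) :
    ¬ CubeIsoperimetricConjecture n ∧
    ∀ V : Set (EuclideanSpace ℝ (Fin n)), IsCubeFace n 0 V →
      volume (tube n V 1) = ENNReal.ofReal (omegaBall n / 2 ^ n) ∧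
      (∀ k < n, ∀ r ∈ Ioc (0 : ℝ) 1, ∀ F E : Set (EuclideanSpace ℝ (Fin n)), IsCubeFace n k F →
        (E = tube n F r ∨ E = unitCube n \ tube n F r) →
        volume E = ENNReal.ofReal (omegaBall n / 2 ^ n) →
        (k = 0 ∧ r = 1 ∧ E = tube n F r) ∨ cubePerimeter n (tube n V 1) < cubePerimeter n E) ∧
      ¬ IsIsoperimetricMinimizer n (omegaBall n / 2 ^ n) (tube n V 1) := by
  have : NeZero n := ⟨by omega⟩
  have hw0 : 0 < omegaBall n / 2 ^ n := div_pos (omegaBall_pos n) (by positivity)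
  have hvertex : ∀ V : Set (EuclideanSpace ℝ (Fin n)), IsCubeFace n 0 V →
      volume (tube n V 1) = ENNReal.ofReal (omegaBall n / 2 ^ n) ∧
      cubePerimeter n (tube n V 1) = ENNReal.ofReal (n * (omegaBall n / 2 ^ n)) := by
    rintro V ⟨S, ε, hε, hcard, rfl⟩
    obtain rfl : S = Finset.univ := Finset.eq_univ_of_card S (by simpa using hcard)
    rw [tube_face_eq_faceTube hε zero_le_one, volume_faceTube hε Finset.univ_nonempty (by simp),
      cubePerimeter_faceTube_univ_one (by omega) hε]
    simp
  have hcompare : ∀ k < n, ∀ r ∈ Ioc (0 : ℝ) 1, ∀ F E : Set (EuclideanSpace ℝ (Fin n)),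
      IsCubeFace n k F → (E = tube n F r ∨ E = unitCube n \ tube n F r) →
      volume E = ENNReal.ofReal (omegaBall n / 2 ^ n) →
      (k = 0 ∧ r = 1 ∧ E = tube n F r) ∨
        ENNReal.ofReal (n * (omegaBall n / 2 ^ n)) < cubePerimeter n E := by
    rintro k hk r hr F E ⟨S, ε, hε, hcard, rfl⟩ hE hvol
    rw [tube_face_eq_faceTube hε hr.1.le] at hE ⊢
    rcases lt_cubePerimeter_of_volume_eq hn hε (Finset.card_pos.1 (by omega)) hr hE hvol with
      ⟨h1, h2, h3⟩ | h
    · exact Or.inl ⟨by omega, h2, h3⟩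
    · exact Or.inr h
  obtain ⟨E₀, hE₀m, hE₀Q, hE₀v, hE₀p⟩ := exists_cubePerimeter_lt hn
  have hprofile : cubeProfile n (omegaBall n / 2 ^ n) <
      ENNReal.ofReal (n * (omegaBall n / 2 ^ n)) :=
    (iInf₂_le_of_le E₀ hE₀m (iInf₂_le hE₀Q hE₀v)).trans_lt hE₀p
  have hnot : ∀ V : Set (EuclideanSpace ℝ (Fin n)), IsCubeFace n 0 V →
      ¬ IsIsoperimetricMinimizer n (omegaBall n / 2 ^ n) (tube n V 1) := by
    rintro V hV ⟨-, -, -, h⟩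
    rw [(hvertex V hV).2] at h
    exact hprofile.ne' h
  have hnotE : ∀ k < n, ∀ r ∈ Ioc (0 : ℝ) 1, ∀ F E : Set (EuclideanSpace ℝ (Fin n)),
      IsCubeFace n k F → (E = tube n F r ∨ E = unitCube n \ tube n F r) →
      ¬ IsIsoperimetricMinimizer n (omegaBall n / 2 ^ n) E := by
    intro k hk r hr F E hF hE hmin
    rcases hcompare k hk r hr F E hF hE hmin.2.2.1 with ⟨rfl, rfl, rfl⟩ | h
    · exact hnot F hF hmin
    · rw [hmin.2.2.2] at h
      exact (h.trans hprofile).false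
  refine ⟨fun hconj => ?_, fun V hV => ⟨(hvertex V hV).1, ?_, hnot V hV⟩⟩
  · have hlt1 : omegaBall n / 2 ^ n < 1 := by
      refine (omegaBall_div_lt_inv hn).trans_le ?_
      have : (1 : ℝ) ≤ n := by exact_mod_cast (by omega : 1 ≤ n)
      exact (div_le_one (by positivity)).2 this
    obtain ⟨k, hk, r, hr, F, hF, h | h⟩ := hconj _ ⟨hw0, hlt1⟩
    · exact hnotE k hk r hr F _ hF (Or.inl rfl) h
    · exact hnotE k hk r hr F _ hF (Or.inr rfl) h
  · rw [(hvertex V hV).2]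
    exact hcompare
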